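/- Let $H$ be a separable complex Hilbert space and let $\alpha\in C^2[0,1]$ be a real function with $\alpha\ge 0$ whose zero set has Lebesgue measure $0$. Let $L^2_\alpha=L^2_\alpha(H,(0,1))$ be the Hilbert space of (classes of) $H$-valued functions on $(0,1)$ that are square integrable with respect to $\alpha(t)\,dt$. For $t\in(0,1)$ let $A_r(t)$ and $A_i(t)$ be (possibly unbounded) self-adjoint operators in $H$ that commute in the strong sense (their resolvents commute), and let $A(t)=A_r(t)+iA_i(t)$ on $D(A_r(t))\cap D(A_i(t))$. Assume that this domain is dense in $H$ and does not depend on $t$; call it $D(A)$. Assume also that for every $f\in D(A)$ the functions $t\mapsto A_r(t)f$ and $t\mapsto A_i(t)f$ are strongly continuously differentiable on $(0,1)$, and that $$A_r(t)=\frac{\alpha'(t)}{2\alpha(t)}I+C\qquad\text{for a.e. }t\in(0,1),$$ where $C$ is a positive self-adjoint operator in $H$ which does not depend on $t$. Let $L_0$ be the closure in $L^2_\alpha$ of the operator $u\mapsto u'(t)+A(t)u(t)$ defined on the finite sums $u(t)=\sum_{k}\varphi_k(t)f_k$ with $\varphi_k\in C_0^\infty(0,1)$ and $f_k\in D(A)$.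 A densely defined closed operator $N$ in a Hilbert space is called normal if $D(N)=D(N^*)$ and $\|Nu\|=\|N^*u\|$ for all $u\in D(N)$. If $C$ has an inverse that is a compact operator on $H$, then every normal extension $L_W$ of $L_0$ in $L^2_\alpha$ has an inverse $L_W^{-1}$ that is a compact operator on $L^2_\alpha$. -/

import Mathlib

open MeasureTheory Set
open scoped ContDiff ENNReal

namespace NormalDiffOp

section Abstract

variable {E : Type*} [NormedAddCommGroup E] [InnerProductSpace ℂ E]

/-- The (possibly unbounded) operator `T` is a bijection of its domain onto the whole space and its
inverse is an (everywhere defined, bounded) compact operator: `T⁻¹ ∈ 𝔖_∞(E)`. -/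
def HasCompactInverse (T : E →ₗ.[ℂ] E) : Prop :=
  ∃ S : E →L[ℂ] E, IsCompactOperator S ∧ ∀ x y : E, (x, y) ∈ T.graph ↔ x = S y

/-- Formally normal operators: densely defined closed `T` with `D(T) ⊆ D(T*)` and
`‖T x‖ = ‖T* x‖` for all `x ∈ D(T)`. -/
structure IsFormallyNormal [CompleteSpace E] (T : E →ₗ.[ℂ] E) : Prop where
  dense_domain : Dense (T.domain : Set E)
  isClosed : T.IsClosed
  domain_le : T.domain ≤ T.adjoint.domain
  norm_eq : ∀ (x : T.domain) (y : T.adjoint.domain), (x : E) = (y : E) → ‖T x‖ = ‖T.adjoint y‖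

/-- Normal operators: formally normal operators `T` with `D(T) = D(T*)`. -/
structure IsNormal [CompleteSpace E] (T : E →ₗ.[ℂ] E) : Prop extends IsFormallyNormal T where
  domain_eq : T.domain = T.adjoint.domain

/-- Commutation of two (unbounded, self-adjoint) operators: `(S - z)⁻¹ T ⊆ T (S - z)⁻¹` for every
non-real `z`. Here `y = (S - z)⁻¹ x`, `w = T x` and `v = T y`, and the last condition says
`v = (S - z)⁻¹ w`. -/
def StronglyCommute (S T : E →ₗ.[ℂ] E) : Prop :=
  ∀ z : ℂ, z.im ≠ 0 → ∀ x y w : E, (y, x + z • y) ∈ S.graph → (x, w) ∈ T.graph →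
    ∃ v : E, (y, v) ∈ T.graph ∧ (v, w + z • v) ∈ S.graph

/-- For every `f ∈ D` the vector function `t ↦ A(t) f` is defined and strongly continuously
differentiable on `(0,1)`. -/
def StronglyC1 (A : ℝ → E →ₗ.[ℂ] E) (D : Submodule ℂ E) : Prop :=
  ∀ f ∈ D, ∃ y : ℝ → E, ContDiffOn ℝ 1 y (Ioo 0 1) ∧ ∀ t ∈ Ioo (0 : ℝ) 1, (f, y t) ∈ (A t).graph

end Abstract

/-- The measure `α(t) dt` on `(0,1)`. -/
noncomputable def weightMeasure (α : ℝ → ℝ) : Measure ℝ :=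
  (volume.restrict (Ioo 0 1)).withDensity (fun t => ENNReal.ofReal (α t))

/-- The weighted Hilbert space `L²_α(H, (0,1))`. -/
noncomputable abbrev WeightedL2 (H : Type*) [NormedAddCommGroup H] (α : ℝ → ℝ) : Type _ :=
  Lp H 2 (weightMeasure α)

/-- Scalar test functions `φ ∈ C_0^∞(0,1)`. -/
structure IsTest (φ : ℝ → ℂ) : Prop where
  smooth : ContDiff ℝ ∞ φ
  compact : HasCompactSupport φ
  supp : tsupport φ ⊆ Ioo 0 1

section Operators

variable {H : Type*} [NormedAddCommGroup H] [InnerProductSpace ℂ H]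

/-- The graph of `L₀'`: the operator `u ↦ u' + A(t) u` on the linear span of the functions
`t ↦ φ(t) f`, with `φ ∈ C_0^∞(0,1)` and `f ∈ D`, as an operator in `L²_α(H, (0,1))`. -/
noncomputable def preminimalGraph (α : ℝ → ℝ) (A : ℝ → H →ₗ.[ℂ] H) (D : Submodule ℂ H) :
    Submodule ℂ (WeightedL2 H α × WeightedL2 H α) :=
  Submodule.span ℂ {p | ∃ (φ : ℝ → ℂ) (f : H) (y : ℝ → H), IsTest φ ∧ f ∈ D ∧
    (∀ t ∈ Ioo (0 : ℝ) 1, (f, y t) ∈ (A t).graph) ∧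
    (p.1 : ℝ → H) =ᵐ[weightMeasure α] (fun t => φ t • f) ∧
    (p.2 : ℝ → H) =ᵐ[weightMeasure α] (fun t => deriv φ t • f + φ t • y t)}

/-- The graph of the minimal operator `L₀`, the closure of `L₀'` in `L²_α(H, (0,1))`. -/
noncomputable def minimalGraph (α : ℝ → ℝ) (A : ℝ → H →ₗ.[ℂ] H) (D : Submodule ℂ H) :
    Submodule ℂ (WeightedL2 H α × WeightedL2 H α) :=
  (preminimalGraph α A D).topologicalClosure

/-- `L` is a normal extension, in `L²_α(H, (0,1))`, of the minimal operator `L₀` generated by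
`u' + A(t) u`. -/
def IsNormalExtension [CompleteSpace H] (α : ℝ → ℝ) (A : ℝ → H →ₗ.[ℂ] H) (D : Submodule ℂ H)
    (L : WeightedL2 H α →ₗ.[ℂ] WeightedL2 H α) : Prop :=
  IsNormal L ∧ minimalGraph α A D ≤ L.graph

end Operators

end NormalDiffOp

namespace NormalDiffOp

/-! ### Graphs, resolvents and eigenprojections of a self-adjoint operator with bounded inverse. -/

section Abstract

variable {E : Type*} [NormedAddCommGroup E] [InnerProductSpace ℂ E]

/-! Put `S = C⁻¹` and let `v = L u` for a normal extension `L`. Normality gives `‖L* u‖ = ‖v‖`, so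
`w = (L u + L* u)/2` and `h = (L u - L* u)/2` have norm at most `‖v‖`. The term `α'/(2α)` is exactly
what makes `d/dt` skew-symmetric in `L²_α`; hence formally `w = C u` and `h = u' + (α'/(2α)) u + i
A_i(t) u`. Both relations are proved weakly, by pairing with `φ ⊗ e`, which lies in the domains of
`L` and of `L*` (`Splitting.exists_weak_parts`).

The first relation gives `u = S w` pointwise (`Splitting.eq_compLp`). So `L` is bounded below, and a
normal operator bounded below is bijective. It also gives compactness in the direction of `H`: since
`S` is compact, some finite sum `W` of its eigenspaces makes `u - P_W u` uniformly small for `‖v‖ ≤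
1` (`exists_isReducing_norm_sub_le`).

The second relation gives compactness in `t`. By strong commutation the eigenspaces of `S` lie in
`D` and are invariant under `A_i(t)` for almost every `t`, so `P_W u` solves a finite system of
differential equations. There the symmetric coefficient drops out of the energy identity `(α ‖P_W
u‖²)' = 2 α Re ⟪P_W u, h⟫`, so `α ‖P_W u‖²` is bounded uniformly up to the endpoints
(`Splitting.sum_sq_norm_div_le`) and short end intervals carry little mass. In between, the
functions `α ⟪e, u⟫` are equicontinuous, hence uniformly close to step functions on a fixed mesh
(`Splitting.exists_finiteDimensional_approx`). Thus `L⁻¹` is a norm limit of finite rank operators.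
-/

theorem inner_eq_of_mem_graph [CompleteSpace E] {T : E →ₗ.[ℂ] E} (hT : IsSelfAdjoint T)
    {x y x' y' : E} (h : (x, y) ∈ T.graph) (h' : (x', y') ∈ T.graph) :
    inner ℂ y x' = inner ℂ x y' := by
  obtain ⟨a, rfl, rfl⟩ := (LinearPMap.mem_graph_iff T).1 h
  obtain ⟨b, rfl, rfl⟩ := (LinearPMap.mem_graph_iff T).1 h'
  have := LinearPMap.adjoint_isFormalAdjoint hT.dense_domain
  rw [LinearPMap.isSelfAdjoint_def.1 hT] at this
  exact this a b

theorem isSymmetric_of_graph_eq [CompleteSpace E] {C : E →ₗ.[ℂ] E} (hC : IsSelfAdjoint C)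
    {S : E →L[ℂ] E} (hS : ∀ x y, (x, y) ∈ C.graph ↔ x = S y) :
    (S : E →ₗ[ℂ] E).IsSymmetric := fun x y =>
  (inner_eq_of_mem_graph hC ((hS _ _).2 rfl : (S x, x) ∈ C.graph)
    ((hS _ _).2 rfl : (S y, y) ∈ C.graph)).symm

theorem injective_of_graph_eq {C : E →ₗ.[ℂ] E} {S : E →L[ℂ] E}
    (hS : ∀ x y, (x, y) ∈ C.graph ↔ x = S y) : Function.Injective S := by
  intro x y h
  exact LinearPMap.mem_graph_snd_inj C ((hS (S x) x).2 rfl) ((hS (S y) y).2 rfl) h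

theorem mem_graph_smul_id_vadd (c : ℂ) (C : E →ₗ.[ℂ] E) (x y : E) :
    (x, y) ∈ ((c • (LinearMap.id : E →ₗ[ℂ] E)) +ᵥ C).graph ↔ (x, y - c • x) ∈ C.graph := by
  simp only [LinearPMap.mem_graph_iff]
  constructor
  · rintro ⟨a, ha, hb⟩
    refine ⟨⟨a, a.2⟩, ha, ?_⟩
    rw [← ha, ← hb, LinearPMap.vadd_apply]
    simp
  · rintro ⟨a, ha, hb⟩
    refine ⟨⟨a, a.2⟩, ha, ?_⟩
    rw [LinearPMap.vadd_apply]
    dsimp at ha hb ⊢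
    rw [hb, ha]
    abel

/-- Here `‖d‖² = z ⟪d, S d⟫` with `⟪d, S d⟫` real, and `z` is not real, so both sides vanish. This
is uniqueness for the resolvent equation of `S⁻¹`, written without the unbounded operator. -/
theorem eq_zero_of_eq_apply_smul {S : E →L[ℂ] E} (hS : (S : E →ₗ[ℂ] E).IsSymmetric)
    {z : ℂ} (hz : z.im ≠ 0) {d : E} (hd : d = S (z • d)) : d = 0 := by
  have h1 : inner ℂ d (S d) = starRingEnd ℂ (inner ℂ d (S d)) := by
    rw [inner_conj_symm]
    exact (hS d d).symm
  have h2 : inner ℂ d d = z * inner ℂ d (S d) := by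
    conv_lhs => rw [hd]
    conv_rhs => rw [← inner_smul_right, ← map_smul, ← hd]
    rw [← hd]
  have h3 : (inner ℂ d d : ℂ) = ((‖d‖ ^ 2 : ℝ) : ℂ) := by
    rw [inner_self_eq_norm_sq_to_K]; push_cast; rfl
  obtain ⟨r, hr⟩ := Complex.conj_eq_iff_real.1 h1.symm
  rw [hr, h3] at h2
  have him := congrArg Complex.im h2
  have hre := congrArg Complex.re h2
  simp only [Complex.ofReal_im, Complex.mul_im, Complex.ofReal_re, mul_zero, zero_add] at him
  simp only [Complex.ofReal_re, Complex.mul_re, Complex.ofReal_im, mul_zero, sub_zero] at hre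
  have : r = 0 := by
    rcases mul_eq_zero.1 him.symm with h | h
    · exact absurd h hz
    · exact h
  rw [this, mul_zero] at hre
  simpa using hre

/-- With `S = C⁻¹`, the resolvent `(C - z)⁻¹` is `z⁻¹ S (z⁻¹ - S)⁻¹`, and the non-real number `z⁻¹`
is outside the spectrum of the self-adjoint `S`. -/
theorem exists_resolvent [CompleteSpace E] {S : E →L[ℂ] E}
    (hS : (S : E →ₗ[ℂ] E).IsSymmetric) {z : ℂ} (hz : z.im ≠ 0) :
    ∃ R : E →L[ℂ] E, ∀ x, R x = S (x + z • R x) := by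
  have hz0 : z ≠ 0 := by rintro rfl; simp at hz
  have hsa : IsSelfAdjoint S := ContinuousLinearMap.isSelfAdjoint_iff_isSymmetric.2 hS
  have hspec : z⁻¹ ∉ spectrum ℂ S := by
    intro h
    have := hsa.im_eq_zero_of_mem_spectrum h
    rw [Complex.inv_im] at this
    rcases div_eq_zero_iff.1 this with h | h
    · exact hz (by simpa using h)
    · exact hz0 (by simpa using h)
  obtain ⟨U, hU⟩ := spectrum.notMem_iff.1 hspec
  have key : ∀ x, z⁻¹ • (↑U⁻¹ : E →L[ℂ] E) x - S ((↑U⁻¹ : E →L[ℂ] E) x) = x := by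
    intro x
    have := congrArg (fun f : E →L[ℂ] E => f x) (U.mul_inv)
    rw [hU] at this
    simpa [Algebra.algebraMap_eq_smul_one] using this
  refine ⟨z⁻¹ • (S.comp (↑U⁻¹ : E →L[ℂ] E)), fun x => ?_⟩
  simp only [smul_apply, ContinuousLinearMap.comp_apply]
  rw [smul_smul, mul_inv_cancel₀ hz0, one_smul]
  nth_rewrite 2 [← key x]
  rw [sub_add_cancel, map_smul]

/-- The orthogonal projection onto an eigenspace of `C⁻¹` maps the graph of every closed operator
commuting with a real translate of `C` into itself. -/
theorem starProjection_eigenspace_mem_graph [CompleteSpace E] {C T : E →ₗ.[ℂ] E} {S : E →L[ℂ] E}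
    (hS : ∀ x y, (x, y) ∈ C.graph ↔ x = S y) (hsym : (S : E →ₗ[ℂ] E).IsSymmetric)
    (hT : T.IsClosed) {c m : ℝ} (hm : m ≠ 0)
    (hcomm : StronglyCommute (((c : ℂ) • (LinearMap.id : E →ₗ[ℂ] E)) +ᵥ C) T)
    (V : Submodule ℂ E) [V.HasOrthogonalProjection] (hV : ∀ x, x ∈ V ↔ S x = (m : ℂ) • x)
    {x w : E} (h : (x, w) ∈ T.graph) :
    (V.starProjection x, V.starProjection w) ∈ T.graph := by
  have hmc : (m : ℂ) ≠ 0 := by exact_mod_cast hm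
  -- The eigenvalue `m` of `S` is the eigenvalue `m⁻¹` of `C`; a shift by `i` makes the resolvent
  -- act as the scalar `i` on the eigenspace.
  set z : ℂ := (m : ℂ)⁻¹ + Complex.I with hzdef
  have hz : z.im ≠ 0 := by
    rw [hzdef, ← Complex.ofReal_inv]; simp
  obtain ⟨R, hR⟩ := exists_resolvent hsym hz
  have huniq : ∀ {x y : E}, y = S (x + z • y) → y = R x := by
    intro x y hy
    refine sub_eq_zero.1 (eq_zero_of_eq_apply_smul hsym hz ?_)
    conv_lhs => rw [hy, hR x, ← map_sub]
    rw [add_sub_add_left_eq_sub, ← smul_sub]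
  have hRT : ∀ {x w : E}, (x, w) ∈ T.graph → (R x, R w) ∈ T.graph := by
    intro x w hxw
    -- The resolvent of `c + C` at `c + z` is the resolvent of `C` at `z`.
    obtain ⟨v, hv, hv'⟩ := hcomm (c + z) (by simpa using hz) x (R x) w
      (by
        rw [mem_graph_smul_id_vadd, hS]
        conv_lhs => rw [hR x]
        congr 1
        rw [add_smul (c : ℂ) z]; abel) hxw
    rw [mem_graph_smul_id_vadd, hS] at hv'
    have : v = R w := by
      apply huniq
      conv_lhs => rw [hv']
      congr 1
      rw [add_smul (c : ℂ) z]; abel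
    rwa [← this]
  -- A Cayley transform, `-(C - m⁻¹ + i)(C - m⁻¹ - i)⁻¹`: a contraction whose fixed space is exactly
  -- the eigenspace. By the mean ergodic theorem its averages converge strongly to the projection,
  -- and each average preserves the closed graph of `T`.
  set f : E →L[ℂ] E := -ContinuousLinearMap.id ℂ E - (2 * Complex.I) • R with hf
  have hfx : ∀ x, f x = -x - (2 * Complex.I) • R x := fun x => by simp [hf]
  have hfix : ∀ x, f x = x ↔ S x = (m : ℂ) • x := by
    intro x
    have h1 : f x = x ↔ R x = Complex.I • x := by
      rw [hfx]
      constructor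
      · intro h
        have h2 : (2 * Complex.I) • R x = (2 * Complex.I) • Complex.I • x := by
          rw [smul_smul, mul_assoc, Complex.I_mul_I]
          have : (2 * Complex.I) • R x = -x - x := by
            nth_rewrite 2 [← h]; abel
          rw [this, mul_neg_one, neg_smul, two_smul]; abel
        exact smul_right_injective _ (by simp : (2 * Complex.I) ≠ 0) h2
      · intro h
        rw [h, smul_smul, mul_assoc, Complex.I_mul_I, mul_neg_one, neg_smul, two_smul]; abel
    have h3 : x + z • Complex.I • x = ((m : ℂ)⁻¹ * Complex.I) • x := by
      rw [smul_smul, hzdef, add_mul, add_smul, Complex.I_mul_I, neg_one_smul]; abel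
    rw [h1]
    constructor
    · intro h
      have h4 := hR x
      rw [h, h3, map_smul] at h4
      have : Complex.I • x = Complex.I • ((m : ℂ)⁻¹ • S x) := by
        rw [h4, smul_smul, mul_comm]
      have := smul_right_injective _ Complex.I_ne_zero this
      rw [this, smul_smul, mul_inv_cancel₀ hmc, one_smul, ← this]
    · intro h
      refine (huniq ?_).symm
      rw [h3, map_smul, h, smul_smul]
      congr 1
      field_simp
  have hnorm : ‖f‖ ≤ 1 := by
    refine ContinuousLinearMap.opNorm_le_bound _ zero_le_one fun x => ?_
    rw [one_mul]
    set y := R x with hy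
    set X := x + z • y with hX
    have hyX : y = S X := hR x
    -- `a = (C - m⁻¹) y`, so `x = a - i y` and `f x = -(a + i y)`. Since `⟪a, y⟫` is real, the cross
    -- terms vanish and the two norms agree.
    set a := X - (m : ℂ)⁻¹ • y with ha
    have hx : x = a - Complex.I • y := by
      rw [ha, hX, hzdef, add_smul]; abel
    have hfa : f x = -(a + Complex.I • y) := by
      rw [hfx, ← hy]
      nth_rewrite 1 [hx]
      rw [mul_smul, two_smul]; abel
    have him : (inner ℂ a y : ℂ).im = 0 := by
      rw [ha, inner_sub_left, inner_smul_left, Complex.sub_im]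
      have h1 : (inner ℂ X y : ℂ).im = 0 := by
        rw [← Complex.conj_eq_iff_im, inner_conj_symm, hyX]
        exact hsym X X
      have h2 : (inner ℂ y y : ℂ) = ((‖y‖ ^ 2 : ℝ) : ℂ) := by
        rw [inner_self_eq_norm_sq_to_K]; push_cast; rfl
      rw [h1, h2, map_inv₀, Complex.conj_ofReal, ← Complex.ofReal_inv, ← Complex.ofReal_mul,
        Complex.ofReal_im, sub_zero]
    have hre : RCLike.re (inner ℂ a (Complex.I • y) : ℂ) = 0 := by
      rw [inner_smul_right]
      simp [him]
    rw [hfa, norm_neg]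
    conv_rhs => rw [hx]
    refine le_of_sq_le_sq ?_ (norm_nonneg _)
    have e1 := norm_add_sq (𝕜 := ℂ) a (Complex.I • y)
    have e2 := norm_sub_sq (𝕜 := ℂ) a (Complex.I • y)
    rw [e1, e2, hre]; simp
  have hVf : V = f.eqLocus (1 : E →L[ℂ] E) := by
    ext x
    rw [hV, ← hfix]
    simp [LinearMap.mem_eqLocus]
  have hlim : ∀ x, Filter.Tendsto (fun n => birkhoffAverage ℂ f _root_.id n x) Filter.atTop
      (nhds (V.starProjection x)) := by
    intro x
    have := f.tendsto_birkhoffAverage_orthogonalProjection hnorm x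
    subst hVf
    exact this
  have hiter : ∀ n, (f^[n] x, f^[n] w) ∈ T.graph := by
    intro n
    induction n with
    | zero => exact h
    | succ n ih =>
      rw [Function.iterate_succ_apply', Function.iterate_succ_apply', hfx, hfx]
      exact T.graph.sub_mem (T.graph.neg_mem ih) (T.graph.smul_mem (2 * Complex.I) (hRT ih))
  have havg : ∀ n, (birkhoffAverage ℂ f _root_.id n x, birkhoffAverage ℂ f _root_.id n w)
      ∈ T.graph := by
    intro n
    have : ((n : ℂ)⁻¹) • ∑ k ∈ Finset.range n, (f^[k] x, f^[k] w) ∈ T.graph :=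
      T.graph.smul_mem _ (T.graph.sum_mem fun k _ => hiter k)
    convert! this using 1
    simp [birkhoffAverage, birkhoffSum, Prod.ext_iff, Prod.fst_sum, Prod.snd_sum]
  exact hT.mem_of_tendsto ((hlim x).prodMk_nhds (hlim w)) (Filter.Eventually.of_forall havg)

end Abstract

/-! ### Strict positivity of the weight. -/

section Weight

/-- By continuity the linear equation `α' = β α` holds everywhere on the interval, so one zero would
force `α` to vanish identically, contradicting the null zero set. -/
theorem pos_of_deriv_eq_mul {α β : ℝ → ℝ} (hα : ContDiffOn ℝ 1 α (Ioo 0 1))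
    (hα_nonneg : ∀ t ∈ Ioo (0 : ℝ) 1, 0 ≤ α t) (hβ : ContinuousOn β (Ioo 0 1))
    (h : ∀ᵐ t ∂(volume.restrict (Ioo (0 : ℝ) 1)), deriv α t = β t * α t)
    (h0 : volume {t ∈ Ioo (0 : ℝ) 1 | α t = 0} = 0) :
    ∀ t ∈ Ioo (0 : ℝ) 1, 0 < α t := by
  intro t₀ ht₀
  refine (hα_nonneg t₀ ht₀).lt_of_ne fun hzero => ?_
  have hderiv : ContinuousOn (deriv α) (Ioo 0 1) :=
    hα.continuousOn_deriv_of_isOpen isOpen_Ioo le_rfl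
  have heq : EqOn (deriv α) (fun t => β t * α t) (Ioo 0 1) :=
    Measure.eqOn_open_of_ae_eq h isOpen_Ioo hderiv (hβ.mul hα.continuousOn)
  have hint : ∀ t ∈ Ioo (0 : ℝ) 1, uIcc t₀ t ⊆ Ioo 0 1 := fun t ht =>
    ordConnected_Ioo.uIcc_subset ht₀ ht
  have hB : ∀ t ∈ Ioo (0 : ℝ) 1, HasDerivAt (fun s => ∫ r in t₀..s, β r) (β t) t := by
    intro t ht
    exact intervalIntegral.integral_hasDerivAt_right
      ((hβ.mono (hint t ht)).intervalIntegrable)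
      (hβ.stronglyMeasurableAtFilter isOpen_Ioo t ht)
      (hβ.continuousAt (isOpen_Ioo.mem_nhds ht))
  have hα' : ∀ t ∈ Ioo (0 : ℝ) 1, HasDerivAt α (β t * α t) t := by
    intro t ht
    rw [← show deriv α t = β t * α t from heq ht]
    exact ((hα.differentiableOn one_ne_zero).differentiableAt
      (isOpen_Ioo.mem_nhds ht)).hasDerivAt
  have hF : ∀ t ∈ Ioo (0 : ℝ) 1,
      HasDerivAt (fun s => α s * Real.exp (-∫ r in t₀..s, β r)) 0 t := by
    intro t ht
    convert! (hα' t ht).mul ((hB t ht).neg.exp) using 1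
    ring
  have hconst : ∀ t ∈ Ioo (0 : ℝ) 1, α t = 0 := by
    intro t ht
    have := isOpen_Ioo.is_const_of_deriv_eq_zero isPreconnected_Ioo
      (fun s hs => (hF s hs).differentiableAt.differentiableWithinAt)
      (fun s hs => (hF s hs).deriv) ht ht₀
    simp only [← hzero, zero_mul, mul_eq_zero, Real.exp_ne_zero, or_false] at this
    exact this
  have : {t ∈ Ioo (0 : ℝ) 1 | α t = 0} = Ioo 0 1 := by
    ext t; exact ⟨fun h => h.1, fun h => ⟨h, hconst t h⟩⟩
  rw [this] at h0
  simp at h0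

end Weight

/-! ### Splitting of the coefficient and reducing subspaces. -/

section Splitting

variable {H : Type*} [NormedAddCommGroup H] [InnerProductSpace ℂ H]

/-- On `(0,1)` the coefficient `A(t)` acts on `D` as `α'(t) / (2 α(t)) + K + i B(t)` with a
constant `K` and a continuous family `B(t)` of symmetric operators; the weight is positive. -/
structure Splitting (α : ℝ → ℝ) (A : ℝ → H →ₗ.[ℂ] H) (D : Submodule ℂ H) (K : D →ₗ[ℂ] H)
    (B : ℝ → D →ₗ[ℂ] H) : Prop where
  pos : ∀ t ∈ Ioo (0 : ℝ) 1, 0 < α t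
  contDiffOn : ContDiffOn ℝ 1 α (Ioo 0 1)
  bounded : ∃ M, ∀ t ∈ Ioo (0 : ℝ) 1, α t ≤ M
  dense : Dense (D : Set H)
  continuousOn : ∀ e : D, ContinuousOn (fun t => B t e) (Ioo 0 1)
  symm : ∀ t ∈ Ioo (0 : ℝ) 1, ∀ e f : D, inner ℂ (B t e) (f : H) = inner ℂ (e : H) (B t f)
  mem_graph : ∀ t ∈ Ioo (0 : ℝ) 1, ∀ e : D,
    ((e : H), ((deriv α t / (2 * α t) : ℝ) : ℂ) • (e : H) + K e + Complex.I • B t e) ∈ (A t).graph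

/-- Finite dimensional subspaces of `D` that are invariant under `S` and almost all `B(t)`. -/
structure IsReducing (S : H →L[ℂ] H) {D : Submodule ℂ H} (B : ℝ → D →ₗ[ℂ] H)
    (W : Submodule ℂ H) : Prop where
  finiteDimensional : FiniteDimensional ℂ W
  le : W ≤ D
  apply_mem : ∀ x ∈ W, S x ∈ W
  ae_apply_mem : ∀ᵐ t ∂(volume.restrict (Ioo (0 : ℝ) 1)), ∀ e : D, (e : H) ∈ W → B t e ∈ W

theorem IsReducing.bot (S : H →L[ℂ] H) {D : Submodule ℂ H} (B : ℝ → D →ₗ[ℂ] H) :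
    IsReducing S B ⊥ where
  finiteDimensional := inferInstance
  le := bot_le
  apply_mem x hx := by
    rw [Submodule.mem_bot] at hx; simp [hx]
  ae_apply_mem := Filter.Eventually.of_forall fun t e he => by
    rw [Submodule.mem_bot, ZeroMemClass.coe_eq_zero] at he; simp [he]

theorem IsReducing.sup {S : H →L[ℂ] H} {D : Submodule ℂ H} {B : ℝ → D →ₗ[ℂ] H}
    {W W' : Submodule ℂ H} (h : IsReducing S B W) (h' : IsReducing S B W') :
    IsReducing S B (W ⊔ W') where
  finiteDimensional := by
    have := h.finiteDimensional
    have := h'.finiteDimensional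
    infer_instance
  le := sup_le h.le h'.le
  apply_mem x hx := by
    obtain ⟨y, hy, z, hz, rfl⟩ := Submodule.mem_sup.1 hx
    rw [map_add]
    exact Submodule.add_mem_sup (h.apply_mem y hy) (h'.apply_mem z hz)
  ae_apply_mem := by
    filter_upwards [h.ae_apply_mem, h'.ae_apply_mem] with t ht ht' e he
    obtain ⟨y, hy, z, hz, hyz⟩ := Submodule.mem_sup.1 he
    have : e = ⟨y, h.le hy⟩ + ⟨z, h'.le hz⟩ := Subtype.ext hyz.symm
    rw [this, map_add]
    exact Submodule.add_mem_sup (ht _ hy) (ht' _ hz)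

/-- A compact operator with totally many reducing eigenspaces is approximated in norm by its
compressions to reducing subspaces. -/
theorem exists_isReducing_norm_sub_le [CompleteSpace H] {S : H →L[ℂ] H} (hS : IsCompactOperator S)
    (hsym : (S : H →ₗ[ℂ] H).IsSymmetric) {D : Submodule ℂ H} {B : ℝ → D →ₗ[ℂ] H}
    (hred : ∀ z : ℂ, IsReducing S B (Module.End.eigenspace (S : Module.End ℂ H) z))
    {ε : ℝ} (hε : 0 < ε) :
    ∃ W : Submodule ℂ H, IsReducing S B W ∧ ∀ (_ : W.HasOrthogonalProjection) (x : H),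
      ‖S x - W.starProjection (S x)‖ ≤ ε * ‖x‖ := by
  classical
  set V := fun z : ℂ => Module.End.eigenspace (S : Module.End ℂ H) z with hVdef
  have hdense : Dense ((⨆ z, V z : Submodule ℂ H) : Set H) := by
    rw [Submodule.dense_iff_topologicalClosure_eq_top,
      Submodule.topologicalClosure_eq_top_iff]
    exact ContinuousLinearMap.orthogonalComplement_iSup_eigenspaces_eq_bot hS hsym
  have hfin : ∀ s : Finset ℂ, IsReducing S B (⨆ z ∈ s, V z) := by
    intro s
    induction s using Finset.induction_on with
    | empty => simpa using IsReducing.bot S B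
    | insert a s _ ih =>
      rw [Finset.iSup_insert]
      exact (hred a).sup ih
  have hc := (hS.isCompact_closure_image_closedBall 1).totallyBounded
  -- A finite `ε/2`-net of the image of the unit ball; each point of the net is moved by less than
  -- `ε/2` to a finite sum of eigenvectors, and `W` collects the eigenspaces that occur.
  obtain ⟨N, hN, hcov⟩ := Metric.totallyBounded_iff.1 hc (ε / 2) (by positivity)
  have hy : ∀ y : H, ∃ s : Finset ℂ, ∃ y' ∈ (⨆ z ∈ s, V z : Submodule ℂ H), dist y y' < ε / 2 := by
    intro y
    obtain ⟨y', hy', hd⟩ := hdense.exists_dist_lt y (half_pos hε)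
    obtain ⟨s, hs⟩ := (Submodule.mem_iSup_iff_exists_finset).1 hy'
    exact ⟨s, y', hs, hd⟩
  choose s y' hy' hd using hy
  set W : Submodule ℂ H := ⨆ z ∈ hN.toFinset.biUnion s, V z with hW
  have hle : ∀ y ∈ N, y' y ∈ W := by
    intro y hyN
    have : (⨆ z ∈ s y, V z : Submodule ℂ H) ≤ W :=
      biSup_mono fun z hz => Finset.mem_biUnion.2 ⟨y, hN.mem_toFinset.2 hyN, hz⟩
    exact this (hy' y)
  refine ⟨W, hfin _, fun _ x => ?_⟩
  have hunit : ∀ x : H, ‖x‖ ≤ 1 → ‖S x - W.starProjection (S x)‖ ≤ ε := by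
    intro x hx
    have hmem : S x ∈ closure (S '' Metric.closedBall 0 1) :=
      subset_closure ⟨x, by simpa using hx, rfl⟩
    obtain ⟨y, hyN, hball⟩ := mem_iUnion₂.1 (hcov hmem)
    rw [Submodule.starProjection_minimal]
    refine (ciInf_le ⟨0, ?_⟩ (⟨y' y, hle y hyN⟩ : W)).trans ?_
    · rintro _ ⟨z, rfl⟩; exact norm_nonneg _
    · rw [← dist_eq_norm]
      have h1 : dist (S x) y < ε / 2 := hball
      have h2 := hd y
      have := dist_triangle (S x) y (y' y)
      dsimp
      linarith
  rcases eq_or_ne x 0 with rfl | hx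
  · simp
  have hx' : 0 < ‖x‖ := norm_pos_iff.2 hx
  have h1 := hunit (((‖x‖⁻¹ : ℝ) : ℂ) • x) (by
    rw [norm_smul, Complex.norm_real, norm_inv, norm_norm, inv_mul_cancel₀ hx'.ne'])
  rw [map_smul, map_smul, ← smul_sub, norm_smul, Complex.norm_real, norm_inv, norm_norm] at h1
  rwa [inv_mul_le_iff₀ hx', mul_comm] at h1

end Splitting

/-! ### Reduction by the eigenspaces of `C⁻¹`, and construction of the splitting. -/

section Splitting

variable {H : Type*} [NormedAddCommGroup H] [InnerProductSpace ℂ H]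

theorem eigenspace_eq_bot_or_real {S : H →L[ℂ] H} (hsym : (S : H →ₗ[ℂ] H).IsSymmetric)
    (hinj : Function.Injective S) (z : ℂ) :
    Module.End.eigenspace (S : Module.End ℂ H) z = ⊥ ∨ ∃ m : ℝ, m ≠ 0 ∧ (m : ℂ) = z := by
  by_cases h : Module.End.eigenspace (S : Module.End ℂ H) z = ⊥
  · exact Or.inl h
  right
  have hz : starRingEnd ℂ z = z := hsym.conj_eigenvalue_eq_self h
  obtain ⟨m, hm⟩ := Complex.conj_eq_iff_real.1 hz
  refine ⟨m, ?_, hm.symm⟩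
  rintro rfl
  refine h ((Submodule.eq_bot_iff _).2 fun x hx => hinj ?_)
  rw [Module.End.mem_eigenspace_iff, hm] at hx
  simpa using hx

/-- The domain and the imaginary part of the coefficient are reduced by the eigenspaces of the
inverse of the constant part. -/
theorem isReducing_eigenspace [CompleteSpace H] {C : H →ₗ.[ℂ] H} {S : H →L[ℂ] H}
    (hS : ∀ x y, (x, y) ∈ C.graph ↔ x = S y) (hsym : (S : H →ₗ[ℂ] H).IsSymmetric)
    (hcomp : IsCompactOperator S) {Ai : ℝ → H →ₗ.[ℂ] H} {D : Submodule ℂ H}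
    (hD_dense : Dense (D : Set H)) {B : ℝ → D →ₗ[ℂ] H} {c : ℝ → ℝ}
    (hAi : ∀ t ∈ Ioo (0 : ℝ) 1, IsSelfAdjoint (Ai t))
    (hB : ∀ t ∈ Ioo (0 : ℝ) 1, ∀ e : D, ((e : H), B t e) ∈ (Ai t).graph)
    (hgood : ∀ᵐ t ∂(volume.restrict (Ioo (0 : ℝ) 1)),
      C.domain ⊓ (Ai t).domain ≤ D ∧
      StronglyCommute (((c t : ℂ) • (LinearMap.id : H →ₗ[ℂ] H)) +ᵥ C) (Ai t)) (z : ℂ) :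
    IsReducing S B (Module.End.eigenspace (S : Module.End ℂ H) z) := by
  have hinj := injective_of_graph_eq hS
  rcases eigenspace_eq_bot_or_real hsym hinj z with h | ⟨m, hm, rfl⟩
  · rw [h]; exact IsReducing.bot S B
  have hmc : (m : ℂ) ≠ 0 := by exact_mod_cast hm
  set V := Module.End.eigenspace (S : Module.End ℂ H) (m : ℂ) with hVdef
  have hV : ∀ x, x ∈ V ↔ S x = (m : ℂ) • x := fun x => Module.End.mem_eigenspace_iff
  have hVfin : FiniteDimensional ℂ V :=
    ContinuousLinearMap.finite_dimensional_eigenspace hcomp _ hmc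
  have hmem : ∀ᵐ t ∂(volume.restrict (Ioo (0 : ℝ) 1)), t ∈ Ioo (0 : ℝ) 1 :=
    ae_restrict_mem measurableSet_Ioo
  have hgood' := hgood.and hmem
  have hproj : ∀ t, t ∈ Ioo (0 : ℝ) 1 →
      StronglyCommute (((c t : ℂ) • (LinearMap.id : H →ₗ[ℂ] H)) +ᵥ C) (Ai t) →
      ∀ {x w : H}, (x, w) ∈ (Ai t).graph →
        (V.starProjection x, V.starProjection w) ∈ (Ai t).graph := fun t ht hc x w hxw =>
    starProjection_eigenspace_mem_graph hS hsym (hAi t ht).isClosed hm hc V hV hxw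
  have hVC : V ≤ C.domain := by
    intro x hx
    refine LinearPMap.mem_domain_of_mem_graph ((hS x ((m : ℂ)⁻¹ • x)).2 ?_)
    rw [map_smul, (hV x).1 hx, smul_smul, inv_mul_cancel₀ hmc, one_smul]
  have hle : V ≤ D := by
    have : (ae (volume.restrict (Ioo (0 : ℝ) 1))).NeBot := by
      rw [ae_neBot]; simp [Measure.restrict_eq_zero]
    obtain ⟨t, ⟨hdom, hcommt⟩, ht⟩ := hgood'.exists
    -- One good `t` suffices, as `D` does not depend on `t`. The projection maps the dense `D` into
    -- `D ⊓ V`, which is finite dimensional and so closed; by density it maps all of `H` there,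
    -- giving `V ≤ D`.
    have hPD : D.map (V.starProjection : H →ₗ[ℂ] H) ≤ D ⊓ V := by
      rintro _ ⟨x, hx, rfl⟩
      have hPV : V.starProjection x ∈ V := V.starProjection_apply_mem x
      exact ⟨hdom ⟨hVC hPV,
        LinearPMap.mem_domain_of_mem_graph (hproj t ht hcommt (hB t ht ⟨x, hx⟩))⟩, hPV⟩
    have hfin : FiniteDimensional ℂ (D ⊓ V : Submodule ℂ H) :=
      Submodule.finiteDimensional_of_le (inf_le_right : D ⊓ V ≤ V)
    have hclosed : IsClosed ((D ⊓ V : Submodule ℂ H) : Set H) :=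
      Submodule.closed_of_finiteDimensional _
    intro x hx
    have hxcl : V.starProjection x ∈ closure ((D ⊓ V : Submodule ℂ H) : Set H) :=
      map_mem_closure V.starProjection.continuous (hD_dense x)
        (fun y hy => hPD ⟨y, hy, rfl⟩)
    rw [hclosed.closure_eq, Submodule.starProjection_eq_self_iff.2 hx] at hxcl
    exact hxcl.1
  refine ⟨hVfin, hle, fun x hx => ?_, ?_⟩
  · rw [(hV x).1 hx]; exact V.smul_mem _ hx
  · filter_upwards [hgood'] with t ⟨⟨_, hcommt⟩, ht⟩ e he
    have h1 := hproj t ht hcommt (hB t ht e)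
    rw [Submodule.starProjection_eq_self_iff.2 he] at h1
    have h2 := LinearPMap.mem_graph_snd_inj (Ai t) (hB t ht e) h1 rfl
    rw [h2]
    exact V.starProjection_apply_mem _

/-- The formula for `A_r(t)` is given only almost everywhere. Strong continuity extends it to every
`t` on vectors of `D`, once `α` is known not to vanish. `K` and `B t` are the restrictions to `D` of
`C` and `A_i(t)`. -/
theorem exists_splitting [CompleteSpace H] [Nontrivial H]
    (α : ℝ → ℝ) (hα : ContDiffOn ℝ 2 α (Icc 0 1)) (hα_nonneg : ∀ t ∈ Icc (0 : ℝ) 1, 0 ≤ α t)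
    (hα_zero : volume {t ∈ Icc (0 : ℝ) 1 | α t = 0} = 0)
    (Ar Ai A : ℝ → H →ₗ.[ℂ] H) (D : Submodule ℂ H)
    (hA : ∀ t ∈ Ioo (0 : ℝ) 1, A t = Ar t + Complex.I • Ai t)
    (hD : ∀ t ∈ Ioo (0 : ℝ) 1, (A t).domain = D) (hD_dense : Dense (D : Set H))
    (hAi : ∀ t ∈ Ioo (0 : ℝ) 1, IsSelfAdjoint (Ai t))
    (hcomm : ∀ t ∈ Ioo (0 : ℝ) 1, StronglyCommute (Ar t) (Ai t))
    (hAr_C1 : StronglyC1 Ar D) (hAi_C1 : StronglyC1 Ai D)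
    (C : H →ₗ.[ℂ] H)
    (hArC : ∀ᵐ t ∂(volume.restrict (Ioo (0 : ℝ) 1)),
      Ar t = (((deriv α t / (2 * α t) : ℝ) : ℂ) • (LinearMap.id : H →ₗ[ℂ] H)) +ᵥ C)
    {S : H →L[ℂ] H} (hS : ∀ x y, (x, y) ∈ C.graph ↔ x = S y)
    (hsym : (S : H →ₗ[ℂ] H).IsSymmetric) (hcomp : IsCompactOperator S) :
    ∃ (K : D →ₗ[ℂ] H) (B : ℝ → D →ₗ[ℂ] H), Splitting α A D K B ∧ (∀ e : D, S (K e) = e) ∧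
      ∀ z : ℂ, IsReducing S B (Module.End.eigenspace (S : Module.End ℂ H) z) := by
  classical
  have hmem : ∀ᵐ t ∂(volume.restrict (Ioo (0 : ℝ) 1)), t ∈ Ioo (0 : ℝ) 1 :=
    ae_restrict_mem measurableSet_Ioo
  have hneBot : (ae (volume.restrict (Ioo (0 : ℝ) 1))).NeBot := by
    rw [ae_neBot]; simp [Measure.restrict_eq_zero]
  have hdomA : ∀ t ∈ Ioo (0 : ℝ) 1, (Ar t).domain ⊓ (Ai t).domain = D := by
    intro t ht
    rw [← hD t ht, hA t ht]; rfl
  have hDAi : ∀ t ∈ Ioo (0 : ℝ) 1, D ≤ (Ai t).domain := fun t ht => by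
    rw [← hdomA t ht]; exact inf_le_right
  have hDC : D ≤ C.domain := by
    obtain ⟨t, h1, ht⟩ := (hArC.and hmem).exists
    have := hdomA t ht
    rw [h1] at this
    rw [← this]; exact inf_le_left
  let K : D →ₗ[ℂ] H := C.toFun.comp (Submodule.inclusion hDC)
  let B : ℝ → D →ₗ[ℂ] H := fun t =>
    if ht : t ∈ Ioo (0 : ℝ) 1 then (Ai t).toFun.comp (Submodule.inclusion (hDAi t ht)) else 0
  have hK : ∀ e : D, ((e : H), K e) ∈ C.graph := fun e => by
    exact (LinearPMap.mem_graph_iff _).2 ⟨⟨e, hDC e.2⟩, rfl, rfl⟩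
  have hB : ∀ t ∈ Ioo (0 : ℝ) 1, ∀ e : D, ((e : H), B t e) ∈ (Ai t).graph := fun t ht e => by
    simp only [B, dif_pos ht]
    exact (LinearPMap.mem_graph_iff _).2 ⟨⟨e, hDAi t ht e.2⟩, rfl, rfl⟩
  have hα1 : ContDiffOn ℝ 1 α (Ioo 0 1) :=
    (hα.mono Ioo_subset_Icc_self).of_le (by norm_num)
  have hderiv : ContinuousOn (deriv α) (Ioo 0 1) :=
    hα1.continuousOn_deriv_of_isOpen isOpen_Ioo le_rfl
  have hα_zero' : volume {t ∈ Ioo (0 : ℝ) 1 | α t = 0} = 0 :=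
    measure_mono_null (t := {t ∈ Icc (0 : ℝ) 1 | α t = 0})
      (fun t ht => ⟨Ioo_subset_Icc_self ht.1, ht.2⟩) hα_zero
  have hα_ne : ∀ᵐ t ∂(volume.restrict (Ioo (0 : ℝ) 1)), α t ≠ 0 := by
    rw [ae_restrict_iff' measurableSet_Ioo, ae_iff]
    convert! hα_zero' using 3
    simp [and_assoc]
  -- the strongly continuous real part
  have hyr : ∀ e : D, ∃ y : ℝ → H, ContinuousOn y (Ioo 0 1) ∧
      (∀ t ∈ Ioo (0 : ℝ) 1, ((e : H), y t) ∈ (Ar t).graph) ∧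
      ∀ᵐ t ∂(volume.restrict (Ioo (0 : ℝ) 1)),
        y t = ((deriv α t / (2 * α t) : ℝ) : ℂ) • (e : H) + K e := by
    intro e
    obtain ⟨y, hy, hgr⟩ := hAr_C1 e e.2
    refine ⟨y, hy.continuousOn, hgr, ?_⟩
    filter_upwards [hArC, hmem] with t h1 ht
    have h2 := hgr t ht
    rw [h1, mem_graph_smul_id_vadd] at h2
    rw [← LinearPMap.mem_graph_snd_inj C h2 (hK e) rfl]
    abel
  have hpos : ∀ t ∈ Ioo (0 : ℝ) 1, 0 < α t := by
    -- Pairing `A_r(t) e - C e` with a nonzero `e` recovers the logarithmic derivative of `α` as an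
    -- almost everywhere equal continuous function.
    obtain ⟨e, he⟩ : ∃ e : D, (e : H) ≠ 0 := by
      by_contra! hcon
      have : (D : Set H) = {0} := by
        ext x
        simp only [SetLike.mem_coe, mem_singleton_iff]
        exact ⟨fun hx => hcon ⟨x, hx⟩, fun hx => hx ▸ D.zero_mem⟩
      rw [this] at hD_dense
      obtain ⟨x, hx⟩ := exists_ne (0 : H)
      have := hD_dense x
      rw [closure_singleton] at this
      exact hx this
    have he2 : (‖(e : H)‖ ^ 2 : ℝ) ≠ 0 := by simpa using he
    obtain ⟨y, hy, hgr, hae⟩ := hyr e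
    refine pos_of_deriv_eq_mul hα1 (fun t ht => hα_nonneg t (Ioo_subset_Icc_self ht))
      (β := fun t => 2 * (inner ℂ (e : H) (y t - K e)).re / ‖(e : H)‖ ^ 2) ?_ ?_ hα_zero'
    · have : ContinuousOn (fun t => inner ℂ (e : H) (y t - K e)) (Ioo 0 1) :=
        continuousOn_const.inner (hy.sub continuousOn_const)
      exact (continuousOn_const.mul (Complex.continuous_re.comp_continuousOn this)).div_const _
    · filter_upwards [hae, hα_ne] with t ht hne
      have hee : (inner ℂ (e : H) (e : H) : ℂ) = ((‖(e : H)‖ ^ 2 : ℝ) : ℂ) := by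
        rw [inner_self_eq_norm_sq_to_K]; push_cast; rfl
      rw [ht, add_sub_cancel_right, inner_smul_right, hee, ← Complex.ofReal_mul,
        Complex.ofReal_re]
      field_simp
  have hg : ContinuousOn (fun t => deriv α t / (2 * α t)) (Ioo 0 1) :=
    hderiv.div (continuousOn_const.mul hα1.continuousOn)
      (fun t ht => mul_ne_zero two_ne_zero (hpos t ht).ne')
  have hAr_graph : ∀ t ∈ Ioo (0 : ℝ) 1, ∀ e : D,
      ((e : H), ((deriv α t / (2 * α t) : ℝ) : ℂ) • (e : H) + K e) ∈ (Ar t).graph := by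
    intro t ht e
    obtain ⟨y, hy, hgr, hae⟩ := hyr e
    have := Measure.eqOn_open_of_ae_eq hae isOpen_Ioo hy
      (((Complex.continuous_ofReal.comp_continuousOn hg).smul continuousOn_const).add
        continuousOn_const) ht
    have h2 := hgr t ht
    rw [this] at h2
    exact h2
  refine ⟨K, B, ⟨hpos, hα1, ?_, hD_dense, ?_, ?_, ?_⟩, fun e => ((hS _ _).1 (hK e)).symm, ?_⟩
  · obtain ⟨M, hM⟩ := isCompact_Icc.exists_bound_of_continuousOn hα.continuousOn
    exact ⟨M, fun t ht => (le_abs_self _).trans (hM t (Ioo_subset_Icc_self ht))⟩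
  · intro e
    obtain ⟨y, hy, hgr⟩ := hAi_C1 e e.2
    refine hy.continuousOn.congr fun t ht => ?_
    exact LinearPMap.mem_graph_snd_inj (Ai t) (hB t ht e) (hgr t ht) rfl
  · intro t ht e f
    exact inner_eq_of_mem_graph (hAi t ht) (hB t ht e) (hB t ht f)
  · intro t ht e
    rw [hA t ht]
    have hea : (e : H) ∈ (Ar t).domain := LinearPMap.mem_domain_of_mem_graph (hAr_graph t ht e)
    have h1 := LinearPMap.mem_graph_snd_inj _ (hAr_graph t ht e)
      ((Ar t).mem_graph ⟨(e : H), hea⟩) rfl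
    have h2 := LinearPMap.mem_graph_snd_inj _ (hB t ht e)
      ((Ai t).mem_graph ⟨(e : H), hDAi t ht e.2⟩) rfl
    refine (LinearPMap.mem_graph_iff _).2 ⟨⟨(e : H), hea, hDAi t ht e.2⟩, rfl, ?_⟩
    rw [h1, h2]
    rfl
  · refine isReducing_eigenspace hS hsym hcomp hD_dense
      (c := fun t => deriv α t / (2 * α t)) hAi hB ?_
    filter_upwards [hArC, hmem] with t h1 ht
    refine ⟨?_, ?_⟩
    · have := hdomA t ht
      rw [h1] at this
      exact this.le
    · rw [← h1]; exact hcomm t ht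

end Splitting

/-! ### Weak derivatives of real functions on the interval. -/

section Primitive

theorem exists_Ioo_of_isCompact {k : Set ℝ} (hk : IsCompact k) (h : k ⊆ Ioo 0 1) :
    ∃ a ∈ Ioo (0 : ℝ) 1, ∃ b ∈ Ioo (0 : ℝ) 1, a < b ∧ k ⊆ Ioo a b := by
  have hk' : IsCompact (insert (1 / 2 : ℝ) k) := hk.insert _
  have hsub : insert (1 / 2 : ℝ) k ⊆ Ioo 0 1 := insert_subset (by norm_num) h
  have hne : (insert (1 / 2 : ℝ) k).Nonempty := insert_nonempty _ _
  have h1 := hsub (hk'.sInf_mem hne)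
  have h2 := hsub (hk'.sSup_mem hne)
  have h3 : ∀ x ∈ insert (1 / 2 : ℝ) k, sInf (insert (1 / 2 : ℝ) k) ≤ x := fun x hx =>
    csInf_le hk'.bddBelow hx
  have h4 : ∀ x ∈ insert (1 / 2 : ℝ) k, x ≤ sSup (insert (1 / 2 : ℝ) k) := fun x hx =>
    le_csSup hk'.bddAbove hx
  have h5 := h3 _ (mem_insert _ _)
  have h6 := h4 _ (mem_insert _ _)
  refine ⟨sInf (insert (1 / 2 : ℝ) k) / 2, ⟨by linarith [h1.1], by linarith [h1.2]⟩,
    (1 + sSup (insert (1 / 2 : ℝ) k)) / 2, ⟨by linarith [h2.1], by linarith [h2.2]⟩,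
    by linarith [h1.1, h2.2], fun x hx => ⟨?_, ?_⟩⟩
  · linarith [h1.1, h3 x (mem_insert_of_mem _ hx)]
  · linarith [h2.2, h4 x (mem_insert_of_mem _ hx)]

theorem intervalIntegrable_of_locallyIntegrableOn {E : Type*} [NormedAddCommGroup E] {f : ℝ → E}
    (hf : LocallyIntegrableOn f (Ioo 0 1)) {a b : ℝ} (ha : a ∈ Ioo (0 : ℝ) 1)
    (hb : b ∈ Ioo (0 : ℝ) 1) : IntervalIntegrable f volume a b :=
  (hf.integrableOn_compact_subset (ordConnected_Ioo.uIcc_subset ha hb)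
    isCompact_uIcc).intervalIntegrable

theorem half_mem_Ioo : (1 / 2 : ℝ) ∈ Ioo (0 : ℝ) 1 := by norm_num

/-- Integration by parts for absolutely continuous functions, on a compact subinterval containing
both the support of `φ` and the base point `1/2`. -/
theorem integral_deriv_mul_primitive {f φ : ℝ → ℝ} (hf : LocallyIntegrableOn f (Ioo 0 1))
    (hφ : ContDiff ℝ ∞ φ) (hc : HasCompactSupport φ) (hs : tsupport φ ⊆ Ioo 0 1) :
    ∫ t, deriv φ t * ∫ s in (1 / 2 : ℝ)..t, f s = -∫ t, φ t * f t := by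
  obtain ⟨a, ha, b, hb, hab, hsub⟩ := exists_Ioo_of_isCompact hc hs
  set P := fun t => ∫ s in (1 / 2 : ℝ)..t, f s with hP
  have hbig : ∃ a' ∈ Ioo (0 : ℝ) 1, ∃ b' ∈ Ioo (0 : ℝ) 1,
      a' ≤ a ∧ a' ≤ 1 / 2 ∧ b ≤ b' ∧ 1 / 2 ≤ b' :=
    ⟨min a (1 / 2), ⟨lt_min ha.1 (by norm_num), (min_le_right _ _).trans_lt (by norm_num)⟩,
      max b (1 / 2), ⟨lt_max_of_lt_right (by norm_num), max_lt hb.2 (by norm_num)⟩,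
      min_le_left _ _, min_le_right _ _, le_max_left _ _, le_max_right _ _⟩
  obtain ⟨a', ha', b', hb', h1, h2, h3, h4⟩ := hbig
  have hab' : a' ≤ b' := h2.trans h4
  have hsub' : tsupport φ ⊆ Ioo a' b' := hsub.trans (Ioo_subset_Ioo h1 h3)
  have hfi := intervalIntegrable_of_locallyIntegrableOn hf ha' hb'
  have hPac : AbsolutelyContinuousOnInterval P a' b' :=
    hfi.absolutelyContinuousOnInterval_intervalIntegral
      (by rw [uIcc_of_le hab']; exact ⟨h2, h4⟩)
  have hφac : AbsolutelyContinuousOnInterval φ a' b' :=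
    ((hφ.of_le (by simp)).contDiffOn).absolutelyContinuousOnInterval
  have hzero : ∀ t, t ∉ Ioo a' b' → φ t = 0 := fun t ht =>
    image_eq_zero_of_notMem_tsupport fun h => ht (hsub' h)
  have hzero' : ∀ t, t ∉ Ioo a' b' → deriv φ t = 0 := fun t ht =>
    image_eq_zero_of_notMem_tsupport fun h => ht (hsub' (tsupport_deriv_subset h))
  have hres : ∀ g : ℝ → ℝ, (∀ t, t ∉ Ioo a' b' → g t = 0) → ∫ t, g t = ∫ t in a'..b', g t := by
    intro g hg
    rw [intervalIntegral.integral_of_le hab', ← integral_indicator measurableSet_Ioc]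
    congr 1
    ext t
    by_cases ht : t ∈ Ioc a' b'
    · rw [indicator_of_mem ht]
    · rw [indicator_of_notMem ht]
      exact hg t fun h => ht (Ioo_subset_Ioc_self h)
  have key := hPac.integral_mul_deriv_eq_deriv_mul hφac
  rw [hzero b' (by simp), hzero a' (by simp), mul_zero, mul_zero, sub_zero, zero_sub] at key
  rw [hres _ fun t ht => by rw [hzero' t ht, zero_mul],
    hres _ fun t ht => by rw [hzero t ht, zero_mul]]
  calc ∫ t in a'..b', deriv φ t * P t = ∫ t in a'..b', P t * deriv φ t := by
        simp_rw [mul_comm]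
    _ = -∫ t in a'..b', deriv P t * φ t := key
    _ = -∫ t in a'..b', φ t * f t := by
        congr 1
        apply intervalIntegral.integral_congr_ae
        filter_upwards [hfi.ae_hasDerivAt_integral] with t ht htm
        rw [(ht (uIoc_subset_uIcc htm) (1 / 2)
          (by rw [uIcc_of_le hab']; exact ⟨h2, h4⟩)).deriv, mul_comm]

theorem integrable_test_mul {G φ : ℝ → ℝ} (hG : LocallyIntegrableOn G (Ioo 0 1))
    (hφ : Continuous φ) (hc : HasCompactSupport φ) (hs : tsupport φ ⊆ Ioo 0 1) :
    Integrable (fun t => φ t * G t) := by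
  have h1 : IntegrableOn G (tsupport φ) := hG.integrableOn_compact_subset hs hc
  have h2 : IntegrableOn (fun t => φ t * G t) (tsupport φ) :=
    h1.continuousOn_mul hφ.continuousOn hc
  refine (integrableOn_iff_integrable_of_support_subset ?_).1 h2
  intro t ht
  refine subset_tsupport φ ?_
  rw [Function.mem_support] at ht ⊢
  exact left_ne_zero_of_mul ht

/-- A function with vanishing weak derivative is a.e. constant. -/
theorem ae_eq_const_of_integral_deriv_mul_eq_zero {G : ℝ → ℝ}
    (hG : LocallyIntegrableOn G (Ioo 0 1))
    (h : ∀ φ : ℝ → ℝ, ContDiff ℝ ∞ φ → HasCompactSupport φ → tsupport φ ⊆ Ioo 0 1 →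
      ∫ t, deriv φ t * G t = 0) :
    ∃ c, ∀ᵐ t ∂(volume.restrict (Ioo (0 : ℝ) 1)), G t = c := by
  let b : ContDiffBump (1 / 2 : ℝ) := ⟨1 / 8, 1 / 4, by norm_num, by norm_num⟩
  set ρ := b.normed volume with hρ
  have hρs : ContDiff ℝ ∞ ρ := b.contDiff_normed
  have hρc : HasCompactSupport ρ := b.hasCompactSupport_normed
  have hρi : ∫ t, ρ t = 1 := b.integral_normed
  have hρt : tsupport ρ ⊆ Ioo 0 1 := by
    rw [hρ, b.tsupport_normed_eq, Real.closedBall_eq_Icc]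
    intro t ht
    have h1 : (1 / 2 - 1 / 4 : ℝ) ≤ t := ht.1
    have h2 : t ≤ (1 / 2 + 1 / 4 : ℝ) := ht.2
    constructor <;> linarith
  set c := ∫ t, ρ t * G t with hc
  refine ⟨c, ?_⟩
  have hGc : LocallyIntegrableOn (fun t => G t - c) (Ioo 0 1) :=
    hG.sub (locallyIntegrableOn_const c)
  have := isOpen_Ioo.ae_eq_zero_of_integral_contDiff_smul_eq_zero hGc ?_
  · rw [ae_restrict_iff' measurableSet_Ioo]
    filter_upwards [this] with t ht htm using sub_eq_zero.1 (ht htm)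
  intro φ hφ hφc hφs
  set I := ∫ t, φ t with hI
  -- Removing the mean of `φ` makes the antiderivative of `χ` compactly supported, hence an
  -- admissible test function.
  set χ := fun t => φ t - I * ρ t with hχ
  have hχs : ContDiff ℝ ∞ χ := hφ.sub (contDiff_const.mul hρs)
  have hφi : Integrable φ := hφ.continuous.integrable_of_hasCompactSupport hφc
  have hρint : Integrable ρ := hρs.continuous.integrable_of_hasCompactSupport hρc
  have hχint : Integrable χ := hφi.sub (hρint.const_mul I)
  have hχI : ∫ t, χ t = 0 := by
    rw [hχ, integral_sub hφi (hρint.const_mul I), integral_const_mul, hρi, mul_one, sub_self]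
  obtain ⟨a, ha, d, hd, had, hsub⟩ := exists_Ioo_of_isCompact
    (hφc.isCompact.union hρc.isCompact) (union_subset hφs hρt)
  have hχ0 : ∀ t, t ∉ Ioo a d → χ t = 0 := by
    intro t ht
    have h1 : φ t = 0 := image_eq_zero_of_notMem_tsupport fun h => ht (hsub (Or.inl h))
    have h2 : ρ t = 0 := image_eq_zero_of_notMem_tsupport fun h => ht (hsub (Or.inr h))
    simp [hχ, h1, h2]
  set ψ := fun t => ∫ s in a..t, χ s with hψ
  have hψd : ∀ t, HasDerivAt ψ (χ t) t := fun t =>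
    (hχs.continuous.integral_hasStrictDerivAt a t).hasDerivAt
  have hψderiv : deriv ψ = χ := funext fun t => (hψd t).deriv
  have hψs : ContDiff ℝ ∞ ψ := by
    rw [contDiff_infty_iff_deriv, hψderiv]
    exact ⟨fun t => (hψd t).differentiableAt, hχs⟩
  have hψ0 : ∀ t, t ∉ Icc a d → ψ t = 0 := by
    intro t ht
    rcases lt_or_ge t a with hta | hta
    · rw [hψ]
      simp only
      rw [intervalIntegral.integral_symm, intervalIntegral.integral_of_le hta.le,
        setIntegral_eq_zero_of_forall_eq_zero, neg_zero]
      intro s hs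
      exact hχ0 s fun h => absurd h.1 (not_lt.2 hs.2)
    · have htd : d < t := by
        by_contra hcon
        exact ht ⟨hta, not_lt.1 hcon⟩
      rw [hψ]
      simp only
      rw [intervalIntegral.integral_of_le hta, ← hχI]
      refine setIntegral_eq_integral_of_forall_compl_eq_zero fun s hs => hχ0 s fun h => hs ?_
      exact ⟨h.1, (h.2.trans htd).le⟩
  have hψt : tsupport ψ ⊆ Icc a d := by
    refine closure_minimal (fun t ht => ?_) isClosed_Icc
    by_contra hcon
    exact ht (hψ0 t hcon)
  have hψc : HasCompactSupport ψ := HasCompactSupport.of_support_subset_isCompact isCompact_Icc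
    ((subset_tsupport ψ).trans hψt)
  have key := h ψ hψs hψc (hψt.trans fun t ht => ⟨ha.1.trans_le ht.1, ht.2.trans_lt hd.2⟩)
  rw [hψderiv] at key
  have hφG := integrable_test_mul hG hφ.continuous hφc hφs
  have hρG := integrable_test_mul hG hρs.continuous hρc hρt
  have e1 : ∫ t, χ t * G t = (∫ t, φ t * G t) - I * c := by
    rw [hc, ← integral_const_mul, ← integral_sub hφG (hρG.const_mul I)]
    congr 1
    ext t
    simp only [hχ]; ring
  have e2 : ∫ t, φ t • (G t - c) = (∫ t, φ t * G t) - I * c := by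
    rw [hI, ← integral_mul_const, ← integral_sub hφG (hφi.mul_const c)]
    congr 1
    ext t
    simp only [smul_eq_mul]; ring
  rw [e2, ← e1, key]

theorem locallyIntegrableOn_primitive {f : ℝ → ℝ} (hf : LocallyIntegrableOn f (Ioo 0 1)) :
    LocallyIntegrableOn (fun t => ∫ s in (1 / 2 : ℝ)..t, f s) (Ioo 0 1) := by
  refine ContinuousOn.locallyIntegrableOn (fun t ht => ?_) measurableSet_Ioo
  obtain ⟨a, ha, b, hb, -, hsub⟩ := exists_Ioo_of_isCompact (k := {1 / 2, t})
    (Set.toFinite _).isCompact (insert_subset half_mem_Ioo (singleton_subset_iff.2 ht))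
  have hfi := intervalIntegrable_of_locallyIntegrableOn hf ha hb
  have h1 : (1 / 2 : ℝ) ∈ Ioo a b := hsub (by simp)
  have h2 : t ∈ Ioo a b := hsub (by simp)
  have hab := h1.1.trans h1.2
  have := (hfi.absolutelyContinuousOnInterval_intervalIntegral (c := 1 / 2)
    (by rw [uIcc_of_le hab.le]; exact Ioo_subset_Icc_self h1)).continuousOn
  rw [uIcc_of_le hab.le] at this
  exact (this.continuousAt (Icc_mem_nhds h2.1 h2.2)).continuousWithinAt

/-- The lemma of du Bois-Reymond. -/
theorem ae_eq_primitive_of_integral_deriv_mul {F f : ℝ → ℝ}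
    (hF : LocallyIntegrableOn F (Ioo 0 1)) (hf : LocallyIntegrableOn f (Ioo 0 1))
    (h : ∀ φ : ℝ → ℝ, ContDiff ℝ ∞ φ → HasCompactSupport φ → tsupport φ ⊆ Ioo 0 1 →
      ∫ t, deriv φ t * F t = -∫ t, φ t * f t) :
    ∃ c, ∀ᵐ t ∂(volume.restrict (Ioo (0 : ℝ) 1)), F t = c + ∫ s in (1 / 2 : ℝ)..t, f s := by
  obtain ⟨c, hc⟩ := ae_eq_const_of_integral_deriv_mul_eq_zero
    (hF.sub (locallyIntegrableOn_primitive hf)) (by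
      intro φ hφ hφc hφs
      have h1 : Continuous (deriv φ) := hφ.continuous_deriv (by simp)
      have h2 : HasCompactSupport (deriv φ) := hφc.deriv
      have h3 : tsupport (deriv φ) ⊆ Ioo 0 1 := (tsupport_deriv_subset).trans hφs
      simp only [Pi.sub_apply, mul_sub]
      rw [integral_sub (integrable_test_mul hF h1 h2 h3)
        (integrable_test_mul (locallyIntegrableOn_primitive hf) h1 h2 h3), h φ hφ hφc hφs,
        integral_deriv_mul_primitive hf hφ hφc hφs, sub_self])
  refine ⟨c, ?_⟩
  filter_upwards [hc] with t ht
  rw [← ht, Pi.sub_apply, sub_add_cancel]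

end Primitive

/-! ### Complex primitives and the scalar energy estimate. -/

section Primitive

/-- On `(0,1)` the function `F` is a locally absolutely continuous primitive of `f`. -/
structure IsPrimitive (F f : ℝ → ℂ) : Prop where
  locallyIntegrableOn : LocallyIntegrableOn f (Ioo 0 1)
  eq_add : ∀ t ∈ Ioo (0 : ℝ) 1, F t = F (1 / 2) + ∫ s in (1 / 2 : ℝ)..t, f s

theorem LocallyIntegrableOn.re {f : ℝ → ℂ} {s : Set ℝ} (hf : LocallyIntegrableOn f s) :
    LocallyIntegrableOn (fun t => (f t).re) s := fun x hx => by
  obtain ⟨u, hu, hi⟩ := hf x hx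
  exact ⟨u, hu, Integrable.re hi⟩

theorem LocallyIntegrableOn.im {f : ℝ → ℂ} {s : Set ℝ} (hf : LocallyIntegrableOn f s) :
    LocallyIntegrableOn (fun t => (f t).im) s := fun x hx => by
  obtain ⟨u, hu, hi⟩ := hf x hx
  exact ⟨u, hu, Integrable.im hi⟩

theorem integrable_test_smul {E : Type*} [NormedAddCommGroup E] [NormedSpace ℝ E] {G : ℝ → E}
    {φ : ℝ → ℝ} (hG : LocallyIntegrableOn G (Ioo 0 1))
    (hφ : Continuous φ) (hc : HasCompactSupport φ) (hs : tsupport φ ⊆ Ioo 0 1) :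
    Integrable (fun t => φ t • G t) := by
  have h1 : IntegrableOn G (tsupport φ) := hG.integrableOn_compact_subset hs hc
  have h2 : IntegrableOn (fun t => φ t • G t) (tsupport φ) :=
    h1.continuousOn_smul hφ.continuousOn hc
  refine (integrableOn_iff_integrable_of_support_subset ?_).1 h2
  intro t ht
  refine subset_tsupport φ ?_
  rw [Function.mem_support] at ht ⊢
  exact left_ne_zero_of_smul ht

theorem intervalIntegral_re {f : ℝ → ℂ} {a b : ℝ} (hf : IntervalIntegrable f volume a b) :
    (∫ t in a..b, f t).re = ∫ t in a..b, (f t).re :=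
  (Complex.reCLM.intervalIntegral_comp_comm hf).symm

theorem intervalIntegral_im {f : ℝ → ℂ} {a b : ℝ} (hf : IntervalIntegrable f volume a b) :
    (∫ t in a..b, f t).im = ∫ t in a..b, (f t).im :=
  (Complex.imCLM.intervalIntegral_comp_comm hf).symm

/-- The du Bois-Reymond lemma applied to real and imaginary parts; real test functions suffice. -/
theorem exists_isPrimitive_of_weak {F f : ℝ → ℂ}
    (hF : LocallyIntegrableOn F (Ioo 0 1)) (hf : LocallyIntegrableOn f (Ioo 0 1))
    (h : ∀ φ : ℝ → ℝ, ContDiff ℝ ∞ φ → HasCompactSupport φ → tsupport φ ⊆ Ioo 0 1 →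
      ∫ t, deriv φ t • F t = -∫ t, φ t • f t) :
    ∃ G, IsPrimitive G f ∧ ∀ᵐ t ∂(volume.restrict (Ioo (0 : ℝ) 1)), F t = G t := by
  obtain ⟨c, hc⟩ := ae_eq_primitive_of_integral_deriv_mul
    (LocallyIntegrableOn.re hF) (LocallyIntegrableOn.re hf) (by
      intro φ hφ hφc hφs
      have h1 := integrable_test_smul hF (hφ.continuous_deriv (by simp)) hφc.deriv
        (tsupport_deriv_subset.trans hφs)
      have h2 := integrable_test_smul hf hφ.continuous hφc hφs
      have e := congrArg Complex.reCLM (h φ hφ hφc hφs)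
      rw [map_neg, ← Complex.reCLM.integral_comp_comm h1,
        ← Complex.reCLM.integral_comp_comm h2] at e
      simpa using e)
  obtain ⟨d, hd⟩ := ae_eq_primitive_of_integral_deriv_mul
    (LocallyIntegrableOn.im hF) (LocallyIntegrableOn.im hf) (by
      intro φ hφ hφc hφs
      have h1 := integrable_test_smul hF (hφ.continuous_deriv (by simp)) hφc.deriv
        (tsupport_deriv_subset.trans hφs)
      have h2 := integrable_test_smul hf hφ.continuous hφc hφs
      have e := congrArg Complex.imCLM (h φ hφ hφc hφs)
      rw [map_neg, ← Complex.imCLM.integral_comp_comm h1,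
        ← Complex.imCLM.integral_comp_comm h2] at e
      simpa using e)
  refine ⟨fun t => ⟨c, d⟩ + ∫ s in (1 / 2 : ℝ)..t, f s, ⟨hf, fun t _ => by simp⟩, ?_⟩
  filter_upwards [hc, hd, ae_restrict_mem measurableSet_Ioo] with t h1 h2 ht
  have hi := intervalIntegrable_of_locallyIntegrableOn hf half_mem_Ioo ht
  apply Complex.ext
  · rw [Complex.add_re, intervalIntegral_re hi, h1]
  · rw [Complex.add_im, intervalIntegral_im hi, h2]

namespace IsPrimitive

variable {F f : ℝ → ℂ}

theorem intervalIntegrable (h : IsPrimitive F f) {a b : ℝ} (ha : a ∈ Ioo (0 : ℝ) 1)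
    (hb : b ∈ Ioo (0 : ℝ) 1) : IntervalIntegrable f volume a b :=
  intervalIntegrable_of_locallyIntegrableOn h.locallyIntegrableOn ha hb

theorem eq_add_integral (h : IsPrimitive F f) {a b : ℝ} (ha : a ∈ Ioo (0 : ℝ) 1)
    (hb : b ∈ Ioo (0 : ℝ) 1) : F b = F a + ∫ s in a..b, f s := by
  rw [h.eq_add a ha, h.eq_add b hb, add_assoc, intervalIntegral.integral_add_adjacent_intervals
    (h.intervalIntegrable half_mem_Ioo ha) (h.intervalIntegrable ha hb)]

theorem absolutelyContinuousOnInterval_re (h : IsPrimitive F f) {a b : ℝ}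
    (ha : a ∈ Ioo (0 : ℝ) 1) (hb : b ∈ Ioo (0 : ℝ) 1) :
    AbsolutelyContinuousOnInterval (fun t => (F t).re) a b := by
  have h1 : AbsolutelyContinuousOnInterval
      (fun t => (F a).re + ∫ s in a..t, (f s).re) a b := by
    have hconst : AbsolutelyContinuousOnInterval (fun _ : ℝ => (F a).re) a b :=
      (contDiff_const.contDiffOn).absolutelyContinuousOnInterval
    exact hconst.add ((intervalIntegrable_of_locallyIntegrableOn
      (LocallyIntegrableOn.re h.locallyIntegrableOn) ha
        hb).absolutelyContinuousOnInterval_intervalIntegral left_mem_uIcc)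
  refine (absolutelyContinuousOnInterval_iff _ _ _).2 fun ε hε => ?_
  obtain ⟨δ, hδ, H⟩ := (absolutelyContinuousOnInterval_iff _ _ _).1 h1 ε hε
  refine ⟨δ, hδ, fun E hE hlt => ?_⟩
  convert H E hE hlt using 1
  refine Finset.sum_congr rfl fun i hi => ?_
  have hmem := hE.1 i hi
  have key : ∀ t ∈ uIcc a b, (F t).re = (F a).re + ∫ s in a..t, (f s).re := by
    intro t ht
    have ht' := ordConnected_Ioo.uIcc_subset ha hb ht
    rw [h.eq_add_integral ha ht', Complex.add_re,
      intervalIntegral_re (h.intervalIntegrable ha ht')]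
  rw [key _ hmem.1, key _ hmem.2]

theorem absolutelyContinuousOnInterval_im (h : IsPrimitive F f) {a b : ℝ}
    (ha : a ∈ Ioo (0 : ℝ) 1) (hb : b ∈ Ioo (0 : ℝ) 1) :
    AbsolutelyContinuousOnInterval (fun t => (F t).im) a b := by
  have h' : IsPrimitive (fun t => -Complex.I * F t) (fun t => -Complex.I * f t) := by
    refine ⟨fun x hx => ?_, fun t ht => ?_⟩
    · obtain ⟨u, hu, hi⟩ := h.locallyIntegrableOn x hx
      exact ⟨u, hu, hi.const_mul _⟩
    · rw [intervalIntegral.integral_const_mul, ← mul_add, ← h.eq_add t ht]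
  simpa using h'.absolutelyContinuousOnInterval_re ha hb

theorem ae_hasDerivAt (h : IsPrimitive F f) {a b : ℝ}
    (ha : a ∈ Ioo (0 : ℝ) 1) (hb : b ∈ Ioo (0 : ℝ) 1) :
    ∀ᵐ t, t ∈ uIcc a b → HasDerivAt F (f t) t := by
  filter_upwards [(h.intervalIntegrable ha hb).ae_hasDerivAt_integral] with t ht htm
  have htI := ordConnected_Ioo.uIcc_subset ha hb htm
  have h1 := (ht htm a left_mem_uIcc).const_add (F a)
  refine h1.congr_of_eventuallyEq ?_
  filter_upwards [isOpen_Ioo.mem_nhds htI] with s hs using h.eq_add_integral ha hs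

end IsPrimitive

/-- The oscillation of `M` is at most `∫ N`, so `M t - ∫ N ≤ M s` for all `s`; averaging over `s` in
an interval of length one gives the bound. No boundary value of `M` is needed. -/
theorem le_integral_add_integral_of_abs_deriv_le {M N : ℝ → ℝ}
    (hac : ∀ a ∈ Ioo (0 : ℝ) 1, ∀ b ∈ Ioo (0 : ℝ) 1, a ≤ b → AbsolutelyContinuousOnInterval M a b)
    (hM : IntegrableOn M (Ioo 0 1)) (hN : IntegrableOn N (Ioo 0 1)) (hN0 : ∀ t ∈ Ioo 0 1, 0 ≤ N t)
    (h : ∀ a ∈ Ioo (0 : ℝ) 1, ∀ b ∈ Ioo (0 : ℝ) 1, a ≤ b →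
      ∀ᵐ t, t ∈ uIcc a b → |deriv M t| ≤ N t) {t : ℝ} (ht : t ∈ Ioo (0 : ℝ) 1) :
    M t ≤ (∫ s in Ioo 0 1, M s) + ∫ s in Ioo 0 1, N s := by
  have hvar : ∀ a ∈ Ioo (0 : ℝ) 1, ∀ b ∈ Ioo (0 : ℝ) 1, a ≤ b →
      |M b - M a| ≤ ∫ s in Ioo 0 1, N s := by
    intro a ha b hb hab
    have hsub : Ioc a b ⊆ Ioo 0 1 := fun s hs => ⟨ha.1.trans hs.1, hs.2.trans_lt hb.2⟩
    rw [← (hac a ha b hb hab).integral_deriv_eq_sub]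
    calc |∫ s in a..b, deriv M s| ≤ ∫ s in a..b, N s := by
          rw [← Real.norm_eq_abs]
          refine intervalIntegral.norm_integral_le_of_norm_le hab ?_ ?_
          · filter_upwards [h a ha b hb hab] with s hs hsm
            exact hs (by rw [uIcc_of_le hab]; exact Ioc_subset_Icc_self hsm)
          · rw [intervalIntegrable_iff_integrableOn_Ioc_of_le hab]
            exact hN.mono_set hsub
      _ ≤ ∫ s in Ioo 0 1, N s := by
          rw [intervalIntegral.integral_of_le hab]
          refine setIntegral_mono_set hN ?_ hsub.eventuallyLE
          filter_upwards [ae_restrict_mem measurableSet_Ioo] with s hs using hN0 s hs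
  have hlow : ∀ s ∈ Ioo (0 : ℝ) 1, M t - ∫ s in Ioo 0 1, N s ≤ M s := by
    intro s hs
    rcases le_total s t with hst | hst
    · linarith [(abs_le.1 (hvar s hs t ht hst)).2]
    · linarith [(abs_le.1 (hvar t ht s hs hst)).1]
  have := setIntegral_mono_on (integrableOn_const (by simp)) hM measurableSet_Ioo hlow
  rw [setIntegral_const] at this
  simp only [Measure.real, Real.volume_Ioo, sub_zero, ENNReal.ofReal_one, ENNReal.toReal_one,
    one_smul] at this
  linarith

/-- Energy estimate: the weighted square norm of a system of primitives is bounded by its integral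
and the integral of a bound for its derivative. -/
theorem sum_sq_norm_div_le {ι : Type*} [Fintype ι] {F f : ι → ℝ → ℂ} {α N : ℝ → ℝ}
    (hα : ContDiffOn ℝ 1 α (Ioo 0 1)) (hpos : ∀ t ∈ Ioo (0 : ℝ) 1, 0 < α t)
    (hF : ∀ k, IsPrimitive (F k) (f k))
    (hM : IntegrableOn (fun t => (∑ k, ‖F k t‖ ^ 2) * (α t)⁻¹) (Ioo 0 1))
    (hN : IntegrableOn N (Ioo 0 1)) (hN0 : ∀ t ∈ Ioo 0 1, 0 ≤ N t)
    (h : ∀ᵐ t ∂(volume.restrict (Ioo (0 : ℝ) 1)),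
      |(∑ k, 2 * (starRingEnd ℂ (F k t) * f k t).re) * (α t)⁻¹
        + (∑ k, ‖F k t‖ ^ 2) * (-deriv α t / α t ^ 2)| ≤ N t)
    {t : ℝ} (ht : t ∈ Ioo (0 : ℝ) 1) :
    (∑ k, ‖F k t‖ ^ 2) * (α t)⁻¹ ≤
      (∫ s in Ioo 0 1, (∑ k, ‖F k s‖ ^ 2) * (α s)⁻¹) + ∫ s in Ioo 0 1, N s := by
  have hsq : ∀ k t, ‖F k t‖ ^ 2 = (F k t).re * (F k t).re + (F k t).im * (F k t).im := by
    intro k t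
    rw [← Complex.normSq_eq_norm_sq, Complex.normSq_apply]
  have hinv : ContDiffOn ℝ 1 (fun t => (α t)⁻¹) (Ioo 0 1) :=
    hα.inv fun t ht => (hpos t ht).ne'
  refine le_integral_add_integral_of_abs_deriv_le (M := fun t => (∑ k, ‖F k t‖ ^ 2) * (α t)⁻¹)
    ?_ hM hN hN0 ?_ ht
  · intro a ha b hb hab
    have h1 : AbsolutelyContinuousOnInterval (fun t => (α t)⁻¹) a b :=
      (hinv.mono (ordConnected_Ioo.uIcc_subset ha hb)).absolutelyContinuousOnInterval
    have h2 : AbsolutelyContinuousOnInterval (fun t => ∑ k, ‖F k t‖ ^ 2) a b := by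
      classical
      have hs : ∀ s : Finset ι,
          AbsolutelyContinuousOnInterval (fun t => ∑ k ∈ s, ‖F k t‖ ^ 2) a b := by
        intro s
        induction s using Finset.induction_on with
        | empty =>
          simp only [Finset.sum_empty]
          exact (contDiff_const.contDiffOn).absolutelyContinuousOnInterval
        | insert k s hk ih =>
          simp only [Finset.sum_insert hk, hsq k]
          exact (((hF k).absolutelyContinuousOnInterval_re ha hb).fun_mul
            ((hF k).absolutelyContinuousOnInterval_re ha hb)).fun_add
            (((hF k).absolutelyContinuousOnInterval_im ha hb).fun_mul
            ((hF k).absolutelyContinuousOnInterval_im ha hb)) |>.fun_add ih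
      exact hs _
    exact h2.fun_mul h1
  · intro a ha b hb hab
    have hd : ∀ᵐ t, ∀ k, t ∈ uIcc a b → HasDerivAt (F k) (f k t) t :=
      ae_all_iff.2 fun k => (hF k).ae_hasDerivAt ha hb
    filter_upwards [hd, (ae_restrict_iff' measurableSet_Ioo).1 h] with t htd hN htm
    have htI := ordConnected_Ioo.uIcc_subset ha hb htm
    have e1 : ∀ k, HasDerivAt (fun s => ‖F k s‖ ^ 2)
        (2 * (starRingEnd ℂ (F k t) * f k t).re) t := by
      intro k
      have hre : HasDerivAt (fun s => (F k s).re) (f k t).re t :=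
        Complex.reCLM.hasFDerivAt.comp_hasDerivAt t (htd k htm)
      have him : HasDerivAt (fun s => (F k s).im) (f k t).im t :=
        Complex.imCLM.hasFDerivAt.comp_hasDerivAt t (htd k htm)
      simp only [hsq]
      convert! (hre.mul hre).add (him.mul him) using 1
      simp only [Complex.mul_re, Complex.conj_re, Complex.conj_im]
      ring
    have e2 : HasDerivAt (fun s => (α s)⁻¹) (-deriv α t / α t ^ 2) t :=
      (((hα.differentiableOn one_ne_zero).differentiableAt
        (isOpen_Ioo.mem_nhds htI)).hasDerivAt).fun_inv (hpos t htI).ne'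
    have e3 := (HasDerivAt.fun_sum (u := Finset.univ) fun k _ => e1 k).fun_mul e2
    rw [e3.deriv]
    exact hN htI

end Primitive

/-! ### The weighted measure and real test functions. -/

/-- Bounded continuously differentiable positive weights on `(0,1)`. -/
structure IsWeight (α : ℝ → ℝ) : Prop where
  pos : ∀ t ∈ Ioo (0 : ℝ) 1, 0 < α t
  contDiffOn : ContDiffOn ℝ 1 α (Ioo 0 1)
  bounded : ∃ M, ∀ t ∈ Ioo (0 : ℝ) 1, α t ≤ M

namespace IsWeight

variable {α : ℝ → ℝ} (hα : IsWeight α)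
include hα

theorem aemeasurable : AEMeasurable (fun t => ENNReal.ofReal (α t))
    (volume.restrict (Ioo (0 : ℝ) 1)) :=
  (hα.contDiffOn.continuousOn.aemeasurable measurableSet_Ioo).ennreal_ofReal

theorem ae_pos : ∀ᵐ t ∂(volume.restrict (Ioo (0 : ℝ) 1)), 0 < α t := by
  filter_upwards [ae_restrict_mem measurableSet_Ioo] with t ht using hα.pos t ht

theorem absolutelyContinuous : volume.restrict (Ioo (0 : ℝ) 1) ≪ weightMeasure α :=
  withDensity_absolutelyContinuous' hα.aemeasurable
    (hα.ae_pos.mono fun _ ht => (ENNReal.ofReal_pos.2 ht).ne')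

theorem ae_eq : ae (weightMeasure α) = ae (volume.restrict (Ioo (0 : ℝ) 1)) :=
  le_antisymm (withDensity_absolutelyContinuous _ _).ae_le hα.absolutelyContinuous.ae_le

theorem isFiniteMeasure : IsFiniteMeasure (weightMeasure α) := by
  obtain ⟨M, hM⟩ := hα.bounded
  refine isFiniteMeasure_withDensity (ne_of_lt ?_)
  calc ∫⁻ t in Ioo (0 : ℝ) 1, ENNReal.ofReal (α t)
      ≤ ∫⁻ _ in Ioo (0 : ℝ) 1, ENNReal.ofReal M :=
        setLIntegral_mono measurable_const fun t ht => ENNReal.ofReal_le_ofReal (hM t ht)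
    _ < ⊤ := by simp

theorem integral_eq {E : Type*} [NormedAddCommGroup E] [NormedSpace ℝ E] (f : ℝ → E) :
    ∫ t, f t ∂(weightMeasure α) = ∫ t in Ioo (0 : ℝ) 1, α t • f t := by
  rw [weightMeasure, integral_withDensity_eq_integral_toReal_smul₀ hα.aemeasurable
    (Filter.Eventually.of_forall fun t => ENNReal.ofReal_lt_top)]
  refine integral_congr_ae ?_
  filter_upwards [hα.ae_pos] with t ht
  rw [ENNReal.toReal_ofReal ht.le]

theorem integrable_iff {E : Type*} [NormedAddCommGroup E] [NormedSpace ℝ E] {f : ℝ → E} :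
    Integrable f (weightMeasure α) ↔ IntegrableOn (fun t => α t • f t) (Ioo 0 1) := by
  rw [weightMeasure, integrable_withDensity_iff_integrable_smul₀' hα.aemeasurable
    (Filter.Eventually.of_forall fun t => ENNReal.ofReal_lt_top)]
  refine integrable_congr ?_
  filter_upwards [hα.ae_pos] with t ht
  rw [ENNReal.toReal_ofReal ht.le]

theorem continuousOn_logDeriv :
    ContinuousOn (fun t => deriv α t / (2 * α t)) (Ioo 0 1) :=
  (hα.contDiffOn.continuousOn_deriv_of_isOpen isOpen_Ioo le_rfl).div
    (continuousOn_const.mul hα.contDiffOn.continuousOn)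
    (fun t ht => mul_ne_zero two_ne_zero (hα.pos t ht).ne')

end IsWeight

/-- Real test functions on `(0,1)`. -/
structure IsRealTest (φ : ℝ → ℝ) : Prop where
  smooth : ContDiff ℝ ∞ φ
  compact : HasCompactSupport φ
  supp : tsupport φ ⊆ Ioo 0 1

namespace IsRealTest

variable {φ ψ : ℝ → ℝ}

protected theorem deriv (h : IsRealTest φ) : IsRealTest (deriv φ) where
  smooth := (contDiff_infty_iff_deriv.1 h.smooth).2
  compact := h.compact.deriv
  supp := tsupport_deriv_subset.trans h.supp

protected theorem mul (h : IsRealTest φ) (h' : IsRealTest ψ) : IsRealTest (fun t => φ t * ψ t) where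
  smooth := h.smooth.mul h'.smooth
  compact := h.compact.mul_right
  supp := (tsupport_mul_subset_left).trans h.supp

theorem hasDerivAt (h : IsRealTest φ) (t : ℝ) : HasDerivAt φ (deriv φ t) t :=
  (h.smooth.differentiable (by simp) t).hasDerivAt

theorem eq_zero (h : IsRealTest φ) {t : ℝ} (ht : t ∉ Ioo (0 : ℝ) 1) : φ t = 0 :=
  image_eq_zero_of_notMem_tsupport fun h' => ht (h.supp h')

theorem isTest (h : IsRealTest φ) : IsTest (fun t => (φ t : ℂ)) := by
  have hsupp : Function.support (fun t => (φ t : ℂ)) = Function.support φ := by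
    ext t; simp
  have ht : tsupport (fun t => (φ t : ℂ)) = tsupport φ := by rw [tsupport, hsupp, tsupport]
  refine ⟨Complex.ofRealCLM.contDiff.comp h.smooth, ?_, ?_⟩
  · rw [HasCompactSupport, ht]; exact h.compact
  · rw [ht]; exact h.supp

theorem continuous_smul {E : Type*} [NormedAddCommGroup E] [NormedSpace ℝ E] (h : IsRealTest φ)
    {y : ℝ → E} (hy : ContinuousOn y (Ioo 0 1)) : Continuous (fun t => φ t • y t) := by
  refine continuous_iff_continuousAt.2 fun t => ?_
  by_cases ht : t ∈ tsupport φ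
  · exact h.smooth.continuous.continuousAt.smul
      (hy.continuousAt (isOpen_Ioo.mem_nhds (h.supp ht)))
  · have : (fun t => φ t • y t) =ᶠ[nhds t] fun _ => 0 := by
      filter_upwards [(isClosed_tsupport φ).isOpen_compl.mem_nhds ht] with s hs
      rw [image_eq_zero_of_notMem_tsupport hs, zero_smul]
    exact continuousAt_const.congr this.symm

/-- The integrand is `(φ α)'` and `φ α` has compact support. This is the integration by parts that
identifies the adjoint on test functions. -/
theorem integral_deriv_mul_add {α : ℝ → ℝ} (h : IsRealTest φ) (hα : ContDiffOn ℝ 1 α (Ioo 0 1)) :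
    Integrable (fun t => deriv φ t * α t + φ t * deriv α t) ∧
    ∫ t, (deriv φ t * α t + φ t * deriv α t) = 0 := by
  have hα' : ContinuousOn (deriv α) (Ioo 0 1) :=
    hα.continuousOn_deriv_of_isOpen isOpen_Ioo le_rfl
  have i1 : Integrable (fun t => deriv φ t * α t) :=
    integrable_test_mul (hα.continuousOn.locallyIntegrableOn measurableSet_Ioo)
      h.deriv.smooth.continuous h.deriv.compact h.deriv.supp
  have i2 : Integrable (fun t => φ t * deriv α t) :=
    integrable_test_mul (hα'.locallyIntegrableOn measurableSet_Ioo)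
      h.smooth.continuous h.compact h.supp
  have i3 : Integrable (fun t => φ t * α t) :=
    integrable_test_mul (hα.continuousOn.locallyIntegrableOn measurableSet_Ioo)
      h.smooth.continuous h.compact h.supp
  refine ⟨i1.add i2, integral_eq_zero_of_hasDerivAt_of_integrable (f := fun t => φ t * α t)
    (fun t => ?_) (i1.add i2) i3⟩
  by_cases ht : t ∈ tsupport φ
  · exact (h.hasDerivAt t).mul ((hα.differentiableOn one_ne_zero).differentiableAt
      (isOpen_Ioo.mem_nhds (h.supp ht))).hasDerivAt
  · have e : (fun t => φ t * α t) =ᶠ[nhds t] fun _ => 0 := by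
      filter_upwards [(isClosed_tsupport φ).isOpen_compl.mem_nhds ht] with s hs
      rw [image_eq_zero_of_notMem_tsupport hs, zero_mul]
    rw [image_eq_zero_of_notMem_tsupport ht,
      image_eq_zero_of_notMem_tsupport fun h' => ht (tsupport_deriv_subset h')]
    simp only [zero_mul, add_zero]
    exact (hasDerivAt_const t (0 : ℝ)).congr_of_eventuallyEq e

end IsRealTest

/-! ### Testing elements of `L²_α` against `φ ⊗ y`. -/

section Lp

variable {H : Type*} [NormedAddCommGroup H] [InnerProductSpace ℂ H] {α : ℝ → ℝ}

theorem IsWeight.exists_test (hα : IsWeight α) {φ : ℝ → ℝ} (hφ : IsRealTest φ) {y : ℝ → H}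
    (hy : ContinuousOn y (Ioo 0 1)) :
    ∃ a : WeightedL2 H α, (a : ℝ → H) =ᵐ[weightMeasure α] fun t => φ t • y t := by
  have := hα.isFiniteMeasure
  have h1 : MemLp (fun t => φ t • y t) 2 (weightMeasure α) :=
    (hφ.continuous_smul hy).memLp_of_hasCompactSupport hφ.compact.smul_right
  exact ⟨h1.toLp, h1.coeFn_toLp⟩

theorem IsWeight.locallyIntegrableOn_inner (hα : IsWeight α) {y : ℝ → H}
    (hy : ContinuousOn y (Ioo 0 1)) (x : WeightedL2 H α) :
    LocallyIntegrableOn (fun t => (α t : ℂ) * inner ℂ (y t) (x t)) (Ioo 0 1) := by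
  have := hα.isFiniteMeasure
  rw [locallyIntegrableOn_iff isOpen_Ioo.isLocallyClosed]
  intro k hk hkc
  obtain ⟨Y, hY⟩ := hkc.exists_bound_of_continuousOn (hy.mono hk)
  have hx1 : Integrable (fun t => ‖x t‖) (weightMeasure α) :=
    ((Lp.memLp x).integrable (by norm_num)).norm
  have hx2 : IntegrableOn (fun t => α t • ‖x t‖) k :=
    ((hα.integrable_iff).1 hx1).mono_set hk
  have hkm : MeasurableSet k := hkc.measurableSet
  have hxm : AEStronglyMeasurable x (volume.restrict k) :=
    ((Lp.aestronglyMeasurable x).mono_ac hα.absolutelyContinuous).mono_measure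
      (Measure.restrict_mono hk le_rfl)
  have hαm : AEStronglyMeasurable (fun t => (α t : ℂ)) (volume.restrict k) :=
    (Complex.continuous_ofReal.comp_continuousOn
      (hα.contDiffOn.continuousOn.mono hk)).aestronglyMeasurable hkm
  refine Integrable.mono' (hx2.const_mul Y)
    (hαm.mul (((hy.mono hk).aestronglyMeasurable_of_isCompact hkc hkm).inner hxm)) ?_
  filter_upwards [ae_restrict_mem hkm] with t ht
  have hp := hα.pos t (hk ht)
  rw [norm_mul, Complex.norm_real, Real.norm_of_nonneg hp.le, smul_eq_mul]
  calc α t * ‖inner ℂ (y t) (x t)‖ ≤ α t * (‖y t‖ * ‖x t‖) := by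
        gcongr; exact norm_inner_le_norm _ _
    _ ≤ α t * (Y * ‖x t‖) := by
        gcongr; exact hY t ht
    _ = Y * (α t * ‖x t‖) := by ring

/-- Moves the weight into the integrand, so inner products in `L²_α` become distributional pairings
for Lebesgue measure, where the du Bois-Reymond lemma applies. -/
theorem IsWeight.inner_test (hα : IsWeight α) {φ : ℝ → ℝ} (hφ : IsRealTest φ) {y : ℝ → H}
    {a : WeightedL2 H α} (ha : (a : ℝ → H) =ᵐ[weightMeasure α] fun t => φ t • y t)
    (x : WeightedL2 H α) :
    inner ℂ a x = ∫ t, φ t • ((α t : ℂ) * inner ℂ (y t) (x t)) := by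
  rw [L2.inner_def, hα.integral_eq, ← integral_indicator measurableSet_Ioo]
  have ha' : (a : ℝ → H) =ᵐ[volume.restrict (Ioo (0 : ℝ) 1)] fun t => φ t • y t := by
    rw [Filter.EventuallyEq, ← hα.ae_eq]; exact ha
  rw [Filter.EventuallyEq, ae_restrict_iff' measurableSet_Ioo] at ha'
  refine integral_congr_ae ?_
  filter_upwards [ha'] with t ht
  by_cases htm : t ∈ Ioo (0 : ℝ) 1
  · rw [indicator_of_mem htm, ht htm, ← Complex.coe_smul (φ t) (y t), inner_smul_left, Complex.conj_ofReal,
      Complex.real_smul, Complex.real_smul]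
    ring
  · rw [indicator_of_notMem htm, hφ.eq_zero htm, zero_smul]

/-- Products of test functions and vectors of a dense subspace are total in `L²_α`. -/
theorem IsWeight.eq_zero_of_inner_test [TopologicalSpace.SeparableSpace H] (hα : IsWeight α)
    {D : Submodule ℂ H} (hD : Dense (D : Set H)) {x : WeightedL2 H α}
    (h : ∀ φ, IsRealTest φ → ∀ e ∈ D, ∫ t, φ t • ((α t : ℂ) * inner ℂ e (x t)) = 0) :
    x = 0 := by
  have : SecondCountableTopology H := UniformSpace.secondCountable_of_separable H
  -- Countability allows a single null set to serve all test vectors.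
  obtain ⟨s, hsD, hsc, hsd⟩ : ∃ s : Set H, s ⊆ D ∧ s.Countable ∧ Dense s := by
    obtain ⟨s, hs, hc, hd⟩ := (TopologicalSpace.IsSeparable.of_separableSpace
      (D : Set H)).exists_countable_dense_subset
    exact ⟨s, hs, hc, fun z => (closure_minimal hd isClosed_closure) (hD z)⟩
  have h1 : ∀ e ∈ s, ∀ᵐ t, t ∈ Ioo (0 : ℝ) 1 → (α t : ℂ) * inner ℂ e (x t) = 0 := by
    intro e he
    exact isOpen_Ioo.ae_eq_zero_of_integral_contDiff_smul_eq_zero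
      (hα.locallyIntegrableOn_inner continuousOn_const x)
      (fun φ h1 h2 h3 => h φ ⟨h1, h2, h3⟩ e (hsD he))
  have h2 := (ae_ball_iff hsc).2 h1
  rw [Lp.eq_zero_iff_ae_eq_zero, Filter.EventuallyEq, hα.ae_eq,
    ae_restrict_iff' measurableSet_Ioo]
  filter_upwards [h2] with t ht htm
  refine hsd.eq_zero_of_inner_right ℂ fun e he => ?_
  exact (mul_eq_zero.1 (ht e he htm)).resolve_left (by exact_mod_cast (hα.pos t htm).ne')

end Lp

/-! ### Real and imaginary parts of a normal extension, in weak form. -/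

section WeakForm

variable {H : Type*} [NormedAddCommGroup H] [InnerProductSpace ℂ H]
  {α : ℝ → ℝ} {A : ℝ → H →ₗ.[ℂ] H} {D : Submodule ℂ H} {K : D →ₗ[ℂ] H} {B : ℝ → D →ₗ[ℂ] H}

theorem Splitting.isWeight (hs : Splitting α A D K B) : IsWeight α :=
  ⟨hs.pos, hs.contDiffOn, hs.bounded⟩

/-- The part `α'(t) / (2 α(t)) + i B(t)` of the coefficient. -/
noncomputable def skewPart (α : ℝ → ℝ) (B : ℝ → D →ₗ[ℂ] H) (e : D) (t : ℝ) : H :=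
  (deriv α t / (2 * α t)) • (e : H) + Complex.I • B t e

theorem Splitting.continuousOn_skewPart (hs : Splitting α A D K B) (e : D) :
    ContinuousOn (skewPart α B e) (Ioo 0 1) :=
  (hs.isWeight.continuousOn_logDeriv.smul continuousOn_const).add
    ((hs.continuousOn e).const_smul Complex.I)

/-- The action of a normal extension and its adjoint on `φ ⊗ e`. -/
theorem Splitting.exists_test_mem_graph [CompleteSpace H] [TopologicalSpace.SeparableSpace H]
    (hs : Splitting α A D K B)
    (hK : ∀ e f : D, inner ℂ (K e) (f : H) = inner ℂ (e : H) (K f))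
    {L : WeightedL2 H α →ₗ.[ℂ] WeightedL2 H α} (hL : IsNormalExtension α A D L)
    {φ : ℝ → ℝ} (hφ : IsRealTest φ) (e : D) :
    ∃ a d k q : WeightedL2 H α,
      (a : ℝ → H) =ᵐ[weightMeasure α] (fun t => φ t • (e : H)) ∧
      (d : ℝ → H) =ᵐ[weightMeasure α] (fun t => deriv φ t • (e : H)) ∧
      (k : ℝ → H) =ᵐ[weightMeasure α] (fun t => φ t • K e) ∧
      (q : ℝ → H) =ᵐ[weightMeasure α] (fun t => φ t • skewPart α B e t) ∧
      (a, d + k + q) ∈ L.graph ∧ (a, k - d - q) ∈ L.adjoint.graph := by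
  have hα := hs.isWeight
  -- the elements of the graph of the minimal operator
  have hgraph : ∀ {φ : ℝ → ℝ} (hφ : IsRealTest φ) (e : D), ∃ a d k q : WeightedL2 H α,
      (a : ℝ → H) =ᵐ[weightMeasure α] (fun t => φ t • (e : H)) ∧
      (d : ℝ → H) =ᵐ[weightMeasure α] (fun t => deriv φ t • (e : H)) ∧
      (k : ℝ → H) =ᵐ[weightMeasure α] (fun t => φ t • K e) ∧
      (q : ℝ → H) =ᵐ[weightMeasure α] (fun t => φ t • skewPart α B e t) ∧
      (a, d + k + q) ∈ L.graph := by
    intro φ hφ e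
    obtain ⟨a, ha⟩ := hα.exists_test hφ (y := fun _ => (e : H)) continuousOn_const
    obtain ⟨d, hd⟩ := hα.exists_test hφ.deriv (y := fun _ => (e : H)) continuousOn_const
    obtain ⟨k, hk⟩ := hα.exists_test hφ (y := fun _ => K e) continuousOn_const
    obtain ⟨q, hq⟩ := hα.exists_test hφ (hs.continuousOn_skewPart e)
    refine ⟨a, d, k, q, ha, hd, hk, hq, hL.2 (Submodule.le_topologicalClosure _
      (Submodule.subset_span ⟨fun t => (φ t : ℂ), e, fun t =>
        ((deriv α t / (2 * α t) : ℝ) : ℂ) • (e : H) + K e + Complex.I • B t e,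
        hφ.isTest, e.2, fun t ht => hs.mem_graph t ht e, ?_, ?_⟩))⟩
    · filter_upwards [ha] with t h1
      simp only [h1, Complex.coe_smul]
    · filter_upwards [hd, hk, hq, Lp.coeFn_add (d + k) q, Lp.coeFn_add d k] with t h1 h2 h3 h4 h5
      rw [h4, Pi.add_apply, h5, Pi.add_apply, h1, h2, h3,
        ((hφ.hasDerivAt t).ofReal_comp).deriv, Complex.coe_smul, Complex.coe_smul,
        Complex.coe_smul, skewPart, smul_add, smul_add, smul_add]
      abel
  obtain ⟨a, d, k, q, ha, hd, hk, hq, hg⟩ := hgraph hφ e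
  refine ⟨a, d, k, q, ha, hd, hk, hq, hg, ?_⟩
  have hdense := hL.1.dense_domain
  have hadj := LinearPMap.adjoint_isFormalAdjoint hdense
  have haL : a ∈ L.domain := LinearPMap.mem_domain_of_mem_graph hg
  -- Normality puts `φ ⊗ e` in the domain of the adjoint; the value there is found by pairing with
  -- the total family `ψ ⊗ f`.
  have haL' : a ∈ L.adjoint.domain := hL.1.domain_le haL
  refine (LinearPMap.mem_graph_iff _).2 ⟨⟨a, haL'⟩, rfl, ?_⟩
  rw [← sub_eq_zero]
  refine hα.eq_zero_of_inner_test hs.dense fun ψ hψ f hf => ?_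
  obtain ⟨b, d', k', q', hb, hd', hk', hq', hg'⟩ := hgraph hψ ⟨f, hf⟩
  rw [← hα.inner_test hψ hb, inner_sub_right]
  obtain ⟨b0, hb0, hb1⟩ := (LinearPMap.mem_graph_iff _).1 hg'
  have e1 : inner ℂ b (L.adjoint ⟨a, haL'⟩) = inner ℂ (d' + k' + q') a := by
    rw [← inner_conj_symm, ← inner_conj_symm (d' + k' + q')]
    congr 1
    have := hadj ⟨a, haL'⟩ b0
    rw [hb0, hb1] at this
    exact this
  rw [e1, L2.inner_def, L2.inner_def, ← integral_sub (L2.integrable_inner _ _)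
    (L2.integrable_inner _ _), hα.integral_eq]
  have hχ := (hψ.mul hφ).integral_deriv_mul_add hs.contDiffOn
  -- The `K` and `B` terms cancel by symmetry, and the two halves `α'/(2α)` add up to the derivative
  -- of the weight, leaving `(ψ φ α)' ⟪f, e⟫`.
  have key : ∀ᵐ t ∂(volume.restrict (Ioo (0 : ℝ) 1)),
      α t • (inner ℂ ((d' + k' + q' : WeightedL2 H α) t) (a t) -
        inner ℂ (b t) ((k - d - q : WeightedL2 H α) t)) =
      (deriv (fun t => ψ t * φ t) t * α t + (ψ t * φ t) * deriv α t) • inner ℂ f (e : H) := by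
    rw [← hα.ae_eq]
    have hmem : ∀ᵐ t ∂(weightMeasure α), t ∈ Ioo (0 : ℝ) 1 := by
      rw [hα.ae_eq]; exact ae_restrict_mem measurableSet_Ioo
    filter_upwards [ha, hd, hk, hq, hb, hd', hk', hq', Lp.coeFn_add (d' + k') q',
      Lp.coeFn_add d' k', Lp.coeFn_sub (k - d) q, Lp.coeFn_sub k d, hmem]
      with t h1 h2 h3 h4 h5 h6 h7 h8 h9 h10 h11 h12 ht
    rw [h9, Pi.add_apply, h10, Pi.add_apply, h11, Pi.sub_apply, h12, Pi.sub_apply, h1, h2, h3, h4,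
      h5, h6, h7, h8, ((hψ.hasDerivAt t).fun_mul (hφ.hasDerivAt t)).deriv]
    have hαt : (α t : ℂ) ≠ 0 := by exact_mod_cast (hs.pos t ht).ne'
    have hB := hs.symm t ht ⟨f, hf⟩ e
    have hKK := hK ⟨f, hf⟩ e
    simp only at hB hKK
    simp only [skewPart, ← Complex.coe_smul, inner_add_left, inner_sub_right, inner_add_right,
      inner_smul_left, inner_smul_right, Complex.conj_ofReal, Complex.conj_I, smul_eq_mul, hB, hKK]
    push_cast
    field_simp
    ring
  rw [integral_congr_ae key, integral_smul_const]
  have hext : ∫ t in Ioo (0 : ℝ) 1,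
      (deriv (fun t => ψ t * φ t) t * α t + (ψ t * φ t) * deriv α t) = 0 := by
    rw [setIntegral_eq_integral_of_forall_compl_eq_zero, hχ.2]
    intro t ht
    rw [(hψ.mul hφ).eq_zero ht, (hψ.mul hφ).deriv.eq_zero ht, zero_mul, zero_mul, add_zero]
  rw [hext, zero_smul]

/-- The real part `w` and the imaginary part `h` of a normal extension act like `K` and like
`d/dt + α' / (2 α) + i B(t)`, in the weak sense. -/
theorem Splitting.exists_weak_parts [CompleteSpace H] [TopologicalSpace.SeparableSpace H]
    (hs : Splitting α A D K B)
    (hK : ∀ e f : D, inner ℂ (K e) (f : H) = inner ℂ (e : H) (K f))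
    {L : WeightedL2 H α →ₗ.[ℂ] WeightedL2 H α} (hL : IsNormalExtension α A D L)
    {u v : WeightedL2 H α} (huv : (u, v) ∈ L.graph) :
    ∃ w h : WeightedL2 H α, ‖w‖ ≤ ‖v‖ ∧ ‖h‖ ≤ ‖v‖ ∧
      (∀ φ, IsRealTest φ → ∀ e : D, ∫ t, φ t • ((α t : ℂ) * inner ℂ (e : H) (w t)) =
        ∫ t, φ t • ((α t : ℂ) * inner ℂ (K e) (u t))) ∧
      ∀ φ, IsRealTest φ → ∀ e : D, ∫ t, deriv φ t • ((α t : ℂ) * inner ℂ (e : H) (u t)) =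
        -∫ t, φ t • ((α t : ℂ) * inner ℂ (e : H) (h t) +
          (α t : ℂ) * inner ℂ (skewPart α B e t) (u t)) := by
  have hα := hs.isWeight
  have hadj := LinearPMap.adjoint_isFormalAdjoint hL.1.dense_domain
  obtain ⟨u0, hu0, hv0⟩ := (LinearPMap.mem_graph_iff _).1 huv
  dsimp only at hu0 hv0
  have huL' : u ∈ L.adjoint.domain := hu0 ▸ hL.1.domain_le u0.2
  set v' := L.adjoint ⟨u, huL'⟩ with hv'
  have hnorm : ‖v‖ = ‖v'‖ := by rw [← hv0]; exact hL.1.norm_eq u0 ⟨u, huL'⟩ hu0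
  -- With `‖v'‖ = ‖v‖` this yields `‖v ± v'‖ ≤ 2 ‖v‖`.
  have hpar := parallelogram_law_with_norm ℂ v v'
  have htwo : ‖(2 : ℂ)⁻¹‖ = 1 / 2 := by norm_num
  have hinner : ∀ {a b b' : WeightedL2 H α}, (a, b) ∈ L.graph → (a, b') ∈ L.adjoint.graph →
      inner ℂ a v = inner ℂ b' u ∧ inner ℂ a v' = inner ℂ b u := by
    intro a b b' hb hb'
    obtain ⟨a0, ha0, hb0⟩ := (LinearPMap.mem_graph_iff _).1 hb
    obtain ⟨a1, ha1, hb1⟩ := (LinearPMap.mem_graph_iff _).1 hb'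
    dsimp only at ha0 hb0 ha1 hb1
    constructor
    · have := hadj a1 u0
      rw [hb1, hu0, ha1, hv0] at this
      exact this.symm
    · have := hadj ⟨u, huL'⟩ a0
      rw [ha0, hb0] at this
      rw [← inner_conj_symm, this, inner_conj_symm]
  refine ⟨(2 : ℂ)⁻¹ • (v + v'), (2 : ℂ)⁻¹ • (v - v'), ?_, ?_, fun φ hφ e => ?_, fun φ hφ e => ?_⟩
  · rw [norm_smul, htwo]
    have h1 : ‖v + v'‖ ≤ 2 * ‖v‖ := by
      refine le_of_sq_le_sq ?_ (by positivity)
      rw [← hnorm] at hpar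
      nlinarith [mul_self_nonneg ‖v - v'‖]
    linarith
  · rw [norm_smul, htwo]
    have h1 : ‖v - v'‖ ≤ 2 * ‖v‖ := by
      refine le_of_sq_le_sq ?_ (by positivity)
      rw [← hnorm] at hpar
      nlinarith [mul_self_nonneg ‖v + v'‖]
    linarith
  · obtain ⟨a, d, k, q, ha, hd, hk, hq, hg, hg'⟩ := hs.exists_test_mem_graph hK hL hφ e
    obtain ⟨h1, h2⟩ := hinner hg hg'
    rw [← hα.inner_test hφ ha, ← hα.inner_test hφ hk, inner_smul_right, inner_add_right, h1, h2]
    simp only [inner_sub_left, inner_add_left]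
    ring
  · obtain ⟨a, d, k, q, ha, hd, hk, hq, hg, hg'⟩ := hs.exists_test_mem_graph hK hL hφ e
    obtain ⟨h1, h2⟩ := hinner hg hg'
    simp only [smul_add]
    rw [integral_add (integrable_test_smul (hα.locallyIntegrableOn_inner continuousOn_const _)
      hφ.smooth.continuous hφ.compact hφ.supp) (integrable_test_smul
      (hα.locallyIntegrableOn_inner (hs.continuousOn_skewPart e) _)
      hφ.smooth.continuous hφ.compact hφ.supp)]
    rw [← hα.inner_test hφ ha, ← hα.inner_test hφ hq,
      ← hα.inner_test hφ.deriv hd, inner_smul_right, inner_sub_right, h1, h2]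
    simp only [inner_sub_left, inner_add_left]
    ring

end WeakForm

/-! ### Invertibility and compactness criteria for normal operators. -/

section Inverse

variable {E : Type*} [NormedAddCommGroup E] [InnerProductSpace ℂ E] [CompleteSpace E]

/-- A normal operator that is bounded below is a bijection. -/
theorem IsNormal.exists_unique_mem_graph {T : E →ₗ.[ℂ] E} (hT : IsNormal T) {c : ℝ}
    (hb : ∀ x y, (x, y) ∈ T.graph → ‖x‖ ≤ c * ‖y‖) (y : E) : ∃! x, (x, y) ∈ T.graph := by
  set f : T.graph →L[ℂ] E := (ContinuousLinearMap.snd ℂ E E).comp T.graph.subtypeL with hf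
  have hfx : ∀ p : T.graph, f p = (p : E × E).2 := fun p => rfl
  have hclosed : IsClosed (T.graph : Set (E × E)) := hT.isClosed
  have : CompleteSpace T.graph := hclosed.completeSpace_coe
  have hanti : AntilipschitzWith (max c 1).toNNReal f := by
    refine f.antilipschitz_of_bound fun p => ?_
    rw [Real.coe_toNNReal _ (le_max_of_le_right zero_le_one)]
    change ‖(p : E × E)‖ ≤ max c 1 * ‖(p : E × E).2‖
    rw [Prod.norm_def]
    refine max_le ((hb _ _ p.2).trans ?_) ?_
    · gcongr; exact le_max_left _ _
    · exact le_mul_of_one_le_left (norm_nonneg _) (le_max_right _ _)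
  have hrange : IsClosed ((LinearMap.range f.toLinearMap : Submodule ℂ E) : Set E) := by
    rw [LinearMap.coe_range]
    exact hanti.isClosed_range f.uniformContinuous
  -- A vector `z` orthogonal to the range satisfies `T* z = 0`; normality gives `T z = 0`, and the
  -- lower bound gives `z = 0`. The range is already closed.
  have htop : (LinearMap.range f.toLinearMap : Submodule ℂ E) = ⊤ := by
    rw [← hrange.submodule_topologicalClosure_eq, Submodule.topologicalClosure_eq_top_iff,
      Submodule.eq_bot_iff]
    intro z hz
    have hz' : ∀ x : T.domain, inner ℂ (0 : E) (x : E) = inner ℂ z (T x) := by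
      intro x
      rw [inner_zero_left, ← inner_conj_symm,
        hz (T x) ⟨⟨((x : E), T x), T.mem_graph x⟩, rfl⟩, map_zero]
    have hzd : z ∈ T.adjoint.domain := LinearPMap.mem_adjoint_domain_of_exists z ⟨0, hz'⟩
    have hz0 : T.adjoint ⟨z, hzd⟩ = 0 := LinearPMap.adjoint_apply_eq hT.dense_domain _ hz'
    have hzd' : z ∈ T.domain := hT.domain_eq ▸ hzd
    have h0 : ‖T ⟨z, hzd'⟩‖ = 0 := by
      rw [hT.norm_eq ⟨z, hzd'⟩ ⟨z, hzd⟩ rfl, hz0, norm_zero]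
    have := hb _ _ (T.mem_graph ⟨z, hzd'⟩)
    rw [h0, mul_zero] at this
    exact norm_le_zero_iff.1 this
  have hy : y ∈ (LinearMap.range f.toLinearMap : Submodule ℂ E) := htop ▸ Submodule.mem_top
  obtain ⟨p, hp⟩ := hy
  refine ⟨(p : E × E).1, ?_, fun x hx => ?_⟩
  · have : (p : E × E) = ((p : E × E).1, y) := Prod.ext rfl hp
    change ((p : E × E).1, y) ∈ T.graph
    rw [← this]; exact p.2
  · have : (⟨(x, y), hx⟩ : T.graph) = p := hanti.injective (by rw [hfx]; exact hp.symm)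
    rw [← this]

/-- Criterion for a normal operator to have a compact inverse. -/
theorem IsNormal.hasCompactInverse {T : E →ₗ.[ℂ] E} (hT : IsNormal T) {c : ℝ}
    (hb : ∀ x y, (x, y) ∈ T.graph → ‖x‖ ≤ c * ‖y‖)
    (happ : ∀ ε > 0, ∃ Z : Submodule ℂ E, FiniteDimensional ℂ Z ∧
      ∀ x y, (x, y) ∈ T.graph → ‖y‖ ≤ 1 → ∃ z ∈ Z, ‖x - z‖ ≤ ε) :
    HasCompactInverse T := by
  choose g hg hguniq using hT.exists_unique_mem_graph hb
  let S₀ : E →ₗ[ℂ] E :=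
    { toFun := g
      map_add' := fun x y => (hguniq _ _ (T.graph.add_mem (hg x) (hg y))).symm
      map_smul' := fun r x => (hguniq _ _ (T.graph.smul_mem r (hg x))).symm }
  let S : E →L[ℂ] E := S₀.mkContinuous c fun y => hb _ _ (hg y)
  have hS : ∀ y, (S y, y) ∈ T.graph := hg
  refine ⟨S, ?_, fun x y => ⟨fun h => hguniq _ _ h, fun h => h ▸ hS y⟩⟩
  have hmem : S ∈ closure {f : E →L[ℂ] E | IsCompactOperator f} := by
    refine Metric.mem_closure_iff.2 fun ε hε => ?_
    obtain ⟨Z, hZ, hZapp⟩ := happ (ε / 2) (by positivity)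
    refine ⟨Z.starProjection.comp S, ?_, ?_⟩
    · have h1 : IsCompactOperator (Z.subtypeL : Z →L[ℂ] E) :=
        have := FiniteDimensional.proper ℂ Z
        isCompactOperator_of_locallyCompactSpace_rng Z.subtypeL
      exact h1.comp_clm (Z.orthogonalProjectionOnto.comp S)
    · rw [dist_eq_norm]
      refine lt_of_le_of_lt (ContinuousLinearMap.opNorm_le_bound' _ (half_pos hε).le fun x hx => ?_)
        (half_lt_self hε)
      have hx' : 0 < ‖x‖ := lt_of_le_of_ne (norm_nonneg _) (Ne.symm hx)
      obtain ⟨z, hz, hle⟩ := hZapp _ _ (hS (((‖x‖⁻¹ : ℝ) : ℂ) • x)) (by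
        rw [norm_smul, Complex.norm_real, norm_inv, norm_norm, inv_mul_cancel₀ hx'.ne'])
      have h2 : ‖S (((‖x‖⁻¹ : ℝ) : ℂ) • x) - Z.starProjection (S (((‖x‖⁻¹ : ℝ) : ℂ) • x))‖
          ≤ ε / 2 := by
        rw [Submodule.starProjection_minimal]
        refine (ciInf_le ⟨0, ?_⟩ (⟨z, hz⟩ : Z)).trans hle
        rintro _ ⟨z, rfl⟩; exact norm_nonneg _
      rw [map_smul, map_smul, ← smul_sub, norm_smul, Complex.norm_real, norm_inv, norm_norm,
        inv_mul_le_iff₀ hx', mul_comm] at h2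
      exact h2
  rwa [isClosed_setOfPred_isCompactOperator.closure_eq] at hmem

end Inverse

/-! ### Pointwise form of the real part, and the energy bound on reducing subspaces. -/

section Energy

variable {H : Type*} [NormedAddCommGroup H] [InnerProductSpace ℂ H]
  {α : ℝ → ℝ} {A : ℝ → H →ₗ.[ℂ] H} {D : Submodule ℂ H} {K : D →ₗ[ℂ] H} {B : ℝ → D →ₗ[ℂ] H}

/-- Testing `w = K u` with `e = S f` and `K (S f) = f` turns it into `⟪f, S w⟫ = ⟪f, u⟫` for a dense
set of `f`. -/
theorem Splitting.eq_compLp [CompleteSpace H] [TopologicalSpace.SeparableSpace H]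
    (hs : Splitting α A D K B) {S : H →L[ℂ] H} (hsym : (S : H →ₗ[ℂ] H).IsSymmetric)
    (hinj : Function.Injective S) (hSK : ∀ e : D, S (K e) = e)
    (hdense : Dense ((D.comap (S : H →ₗ[ℂ] H) : Submodule ℂ H) : Set H))
    {u w : WeightedL2 H α}
    (h : ∀ φ, IsRealTest φ → ∀ e : D, ∫ t, φ t • ((α t : ℂ) * inner ℂ (e : H) (w t)) =
      ∫ t, φ t • ((α t : ℂ) * inner ℂ (K e) (u t))) :
    u = S.compLp w := by
  have hα := hs.isWeight
  rw [← sub_eq_zero]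
  refine hα.eq_zero_of_inner_test hdense fun φ hφ f hf => ?_
  obtain ⟨a, ha⟩ := hα.exists_test hφ (y := fun _ => f) continuousOn_const
  have hKf : K ⟨S f, hf⟩ = f := hinj (hSK ⟨S f, hf⟩)
  have h1 := h φ hφ ⟨S f, hf⟩
  rw [hKf] at h1
  rw [← hα.inner_test hφ ha, inner_sub_right, hα.inner_test hφ ha, hα.inner_test hφ ha, ← h1,
    sub_eq_zero]
  refine integral_congr_ae ?_
  have h2 := S.coeFn_compLp w
  rw [hα.ae_eq, ae_restrict_iff' measurableSet_Ioo] at h2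
  filter_upwards [h2] with t ht
  by_cases htm : t ∈ Ioo (0 : ℝ) 1
  · rw [ht htm]
    congr 2
    exact hsym f (w t)
  · simp [hφ.eq_zero htm]

theorem IsWeight.norm_sq_eq (hα : IsWeight α) (x : WeightedL2 H α) :
    IntegrableOn (fun t => α t * ‖x t‖ ^ 2) (Ioo 0 1) ∧
    ‖x‖ ^ 2 = ∫ t in Ioo (0 : ℝ) 1, α t * ‖x t‖ ^ 2 := by
  have h1 : Integrable (fun t => ‖x t‖ ^ 2) (weightMeasure α) := (Lp.memLp x).integrable_norm_pow
    (by norm_num)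
  refine ⟨hα.integrable_iff.1 h1, ?_⟩
  have h2 : ((‖x‖ ^ 2 : ℝ) : ℂ) = inner ℂ x x := by
    rw [inner_self_eq_norm_sq_to_K]; push_cast; rfl
  rw [L2.inner_def] at h2
  have h3 : ∀ t, (inner ℂ (x t) (x t) : ℂ) = ((‖x t‖ ^ 2 : ℝ) : ℂ) := fun t => by
    rw [inner_self_eq_norm_sq_to_K]; push_cast; rfl
  simp_rw [h3] at h2
  rw [integral_complex_ofReal] at h2
  have h4 : ‖x‖ ^ 2 = ∫ t, ‖x t‖ ^ 2 ∂(weightMeasure α) := by exact_mod_cast h2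
  rw [h4, hα.integral_eq]
  rfl

/-- The right-hand side of the weak differential equation for `α ⟪e, u⟫`. -/
noncomputable def weakRHS (α : ℝ → ℝ) (B : ℝ → D →ₗ[ℂ] H) (u h : WeightedL2 H α) (e : D)
    (t : ℝ) : ℂ :=
  (α t : ℂ) * inner ℂ (e : H) (h t) + (α t : ℂ) * inner ℂ (skewPart α B e t) (u t)

theorem Splitting.exists_isPrimitive (hs : Splitting α A D K B) {u h : WeightedL2 H α} (e : D)
    (hw : ∀ φ, IsRealTest φ → ∫ t, deriv φ t • ((α t : ℂ) * inner ℂ (e : H) (u t)) =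
      -∫ t, φ t • weakRHS α B u h e t) :
    ∃ G, IsPrimitive G (weakRHS α B u h e) ∧
      ∀ᵐ t ∂(volume.restrict (Ioo (0 : ℝ) 1)), (α t : ℂ) * inner ℂ (e : H) (u t) = G t :=
  exists_isPrimitive_of_weak (hs.isWeight.locallyIntegrableOn_inner continuousOn_const u)
    ((hs.isWeight.locallyIntegrableOn_inner continuousOn_const h).add
      (hs.isWeight.locallyIntegrableOn_inner (hs.continuousOn_skewPart e) u))
    fun φ h1 h2 h3 => hw φ ⟨h1, h2, h3⟩

theorem starProjection_eq_sum {W : Submodule ℂ H} [W.HasOrthogonalProjection] {ι : Type*}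
    [Fintype ι] (b : OrthonormalBasis ι ℂ W) (x : H) :
    W.starProjection x = ∑ k, inner ℂ (b k : H) x • (b k : H) := by
  rw [b.starProjection_eq_sum_rankOne, sum_apply]
  simp

theorem norm_sq_sum_smul {W : Submodule ℂ H} {ι : Type*}
    [Fintype ι] (b : OrthonormalBasis ι ℂ W) (c : ι → ℂ) :
    ‖∑ k, c k • (b k : H)‖ ^ 2 = ∑ k, ‖c k‖ ^ 2 := by
  have h1 : ∑ k, c k • (b k : H) = ((∑ k, c k • b k : W) : H) := by
    rw [Submodule.coe_sum]; simp
  rw [h1, ← Submodule.coe_norm, ← b.sum_sq_norm_inner_right]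
  congr 1 with k
  rw [b.orthonormal.inner_right_fintype]

/-- Pointwise energy identity: the contribution of the symmetric operators cancels. -/
theorem abs_energy_le {W : Submodule ℂ H} [W.HasOrthogonalProjection] (hWD : W ≤ D) {ι : Type*}
    [Fintype ι] (b : OrthonormalBasis ι ℂ W) {a a' : ℝ} (ha : 0 < a) {Bt : D →ₗ[ℂ] H}
    (hsymm : ∀ e f : D, inner ℂ (Bt e) (f : H) = inner ℂ (e : H) (Bt f))
    (hinv : ∀ e : D, (e : H) ∈ W → Bt e ∈ W) (x y : H) (F f : ι → ℂ)
    (hF : ∀ k, F k = (a : ℂ) * inner ℂ (b k : H) x)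
    (hf : ∀ k, f k = (a : ℂ) * inner ℂ (b k : H) y +
      (a : ℂ) * inner ℂ ((a' / (2 * a)) • (b k : H) + Complex.I • Bt ⟨b k, hWD (b k).2⟩) x) :
    |(∑ k, 2 * (starRingEnd ℂ (F k) * f k).re) * a⁻¹ + (∑ k, ‖F k‖ ^ 2) * (-a' / a ^ 2)| ≤
      a * (‖x‖ ^ 2 + ‖y‖ ^ 2) := by
  set p : H := W.starProjection x with hp
  have hpW : p ∈ W := W.starProjection_apply_mem x
  have hpsum : p = ∑ k, inner ℂ (b k : H) x • (b k : H) := starProjection_eq_sum b x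
  have hpnorm : ‖p‖ ≤ ‖x‖ := W.norm_starProjection_apply_le x
  have hBp : (∑ k, starRingEnd ℂ (inner ℂ (b k : H) x) *
      inner ℂ (Bt ⟨b k, hWD (b k).2⟩) x : ℂ) = inner ℂ (Bt ⟨p, hWD hpW⟩) x := by
    have h1 : (⟨p, hWD hpW⟩ : D) = ∑ k, inner ℂ (b k : H) x • (⟨b k, hWD (b k).2⟩ : D) := by
      apply Subtype.ext
      rw [Submodule.coe_sum]
      simpa using hpsum
    rw [h1, map_sum, sum_inner]
    simp only [map_smul, inner_smul_left]
  have him : (inner ℂ (Bt ⟨p, hWD hpW⟩) x : ℂ).im = 0 := by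
    -- Invariance of `W` is used here: `x` can be replaced by its projection, and the quadratic form
    -- of a symmetric operator is real.
    have h1 : inner ℂ (Bt ⟨p, hWD hpW⟩) x = inner ℂ (Bt ⟨p, hWD hpW⟩) p := by
      have := W.starProjection_inner_eq_zero x (Bt ⟨p, hWD hpW⟩) (hinv _ hpW)
      rwa [inner_eq_zero_symm, inner_sub_right, sub_eq_zero] at this
    rw [h1, ← Complex.conj_eq_iff_im, inner_conj_symm]
    exact (hsymm ⟨p, hWD hpW⟩ ⟨p, hWD hpW⟩).symm
  have hpy : (∑ k, starRingEnd ℂ (inner ℂ (b k : H) x) * inner ℂ (b k : H) y : ℂ) =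
      inner ℂ p y := by
    rw [hpsum, sum_inner]
    simp [inner_smul_left]
  -- The terms with `a'` cancel: the coefficient `a' / (2a)` compensates the derivative of the
  -- factor `a⁻¹`.
  have hterm : ∀ k, 2 * (starRingEnd ℂ (F k) * f k).re * a⁻¹ + ‖F k‖ ^ 2 * (-a' / a ^ 2) =
      2 * a * (starRingEnd ℂ (inner ℂ (b k : H) x) * inner ℂ (b k : H) y).re +
      2 * a * (starRingEnd ℂ (inner ℂ (b k : H) x) *
        inner ℂ (Bt ⟨b k, hWD (b k).2⟩) x).im := by
    intro k
    rw [hF, hf, inner_add_left, ← Complex.coe_smul, inner_smul_left, inner_smul_left, norm_mul,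
      mul_pow, ← Complex.normSq_eq_norm_sq (inner ℂ (b k : H) x), Complex.normSq_apply,
      Complex.norm_real, Real.norm_of_nonneg ha.le, Complex.conj_ofReal, Complex.conj_I]
    simp only [map_mul, Complex.conj_ofReal, Complex.mul_re, Complex.mul_im, Complex.add_re,
      Complex.add_im, Complex.ofReal_re, Complex.ofReal_im, Complex.conj_re, Complex.conj_im,
      Complex.neg_re, Complex.neg_im, Complex.I_re, Complex.I_im]
    field_simp
    ring
  rw [Finset.sum_mul, Finset.sum_mul, ← Finset.sum_add_distrib, Finset.sum_congr rfl
    fun k _ => hterm k, Finset.sum_add_distrib, ← Finset.mul_sum, ← Finset.mul_sum,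
    ← Complex.re_sum, ← Complex.im_sum, hBp, hpy, him, mul_zero, add_zero, abs_mul,
    abs_of_pos (by positivity : 0 < 2 * a)]
  have h1 : |(inner ℂ p y : ℂ).re| ≤ ‖x‖ * ‖y‖ :=
    (Complex.abs_re_le_norm _).trans ((norm_inner_le_norm _ _).trans (by gcongr))
  nlinarith [sq_nonneg (‖x‖ - ‖y‖)]

/-- Uniform bound for the components of `u` in a reducing subspace. -/
theorem Splitting.sum_sq_norm_div_le [CompleteSpace H] (hs : Splitting α A D K B) {S : H →L[ℂ] H}
    {W : Submodule ℂ H} (hW : IsReducing S B W) {ι : Type*} [Fintype ι]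
    (b : OrthonormalBasis ι ℂ W) {u h : WeightedL2 H α} {G : ι → ℝ → ℂ}
    (hG : ∀ k, IsPrimitive (G k) (weakRHS α B u h ⟨b k, hW.le (b k).2⟩))
    (hGu : ∀ k, ∀ᵐ t ∂(volume.restrict (Ioo (0 : ℝ) 1)),
      (α t : ℂ) * inner ℂ (b k : H) (u t) = G k t) {t : ℝ} (ht : t ∈ Ioo (0 : ℝ) 1) :
    (∑ k, ‖G k t‖ ^ 2) * (α t)⁻¹ ≤ 2 * ‖u‖ ^ 2 + ‖h‖ ^ 2 := by
  have := hW.finiteDimensional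
  have hα := hs.isWeight
  obtain ⟨hui, hun⟩ := hα.norm_sq_eq u
  obtain ⟨hhi, hhn⟩ := hα.norm_sq_eq h
  have hMeq : ∀ᵐ t ∂(volume.restrict (Ioo (0 : ℝ) 1)),
      (∑ k, ‖G k t‖ ^ 2) * (α t)⁻¹ = α t * ‖W.starProjection (u t)‖ ^ 2 := by
    filter_upwards [ae_all_iff.2 hGu, hα.ae_pos] with t ht hpos
    rw [starProjection_eq_sum b, norm_sq_sum_smul]
    simp_rw [← ht, norm_mul, mul_pow, Complex.norm_real, Real.norm_of_nonneg hpos.le]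
    rw [← Finset.mul_sum]
    field_simp
  have hMle : ∀ᵐ t ∂(volume.restrict (Ioo (0 : ℝ) 1)),
      α t * ‖W.starProjection (u t)‖ ^ 2 ≤ α t * ‖u t‖ ^ 2 := by
    filter_upwards [hα.ae_pos] with t hpos
    gcongr
    exact W.norm_starProjection_apply_le _
  have hum : AEStronglyMeasurable u (volume.restrict (Ioo (0 : ℝ) 1)) :=
    (Lp.aestronglyMeasurable u).mono_ac hα.absolutelyContinuous
  have hPi : IntegrableOn (fun t => α t * ‖W.starProjection (u t)‖ ^ 2) (Ioo 0 1) := by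
    refine Integrable.mono' hui ?_ ?_
    · exact (hα.contDiffOn.continuousOn.aestronglyMeasurable measurableSet_Ioo).mul
        ((W.starProjection.continuous.comp_aestronglyMeasurable hum).norm.pow 2)
    · filter_upwards [hMle, hα.ae_pos] with t h1 h2
      rwa [Real.norm_of_nonneg (by positivity)]
  have hM : IntegrableOn (fun t => (∑ k, ‖G k t‖ ^ 2) * (α t)⁻¹) (Ioo 0 1) :=
    hPi.congr (hMeq.mono fun t ht => ht.symm)
  have hN : IntegrableOn (fun t => α t * ‖u t‖ ^ 2 + α t * ‖h t‖ ^ 2) (Ioo 0 1) := hui.add hhi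
  have key := NormalDiffOp.sum_sq_norm_div_le hα.contDiffOn hα.pos hG hM hN
    (fun t ht => by have := hα.pos t ht; positivity) (by
      filter_upwards [ae_all_iff.2 hGu, hW.ae_apply_mem, ae_restrict_mem measurableSet_Ioo]
        with t h1 h2 h3
      rw [← mul_add]
      exact abs_energy_le hW.le b (hα.pos t h3) (hs.symm t h3) h2 (u t) (h t)
        (fun k => G k t) _ (fun k => (h1 k).symm) (fun k => rfl)) ht
  refine key.trans ?_
  rw [integral_add hui hhi, ← hun, ← hhn, integral_congr_ae hMeq]
  have := integral_mono_ae hPi hui hMle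
  rw [← hun] at this
  linarith

end Energy

/-! ### Equicontinuity and finite dimensional approximation in `t`. -/

section Approximation

variable {H : Type*} [NormedAddCommGroup H] [InnerProductSpace ℂ H]
  {α : ℝ → ℝ} {A : ℝ → H →ₗ.[ℂ] H} {D : Submodule ℂ H} {K : D →ₗ[ℂ] H} {B : ℝ → D →ₗ[ℂ] H}

theorem le_mul_sq_add {l x : ℝ} (hl : 0 < l) : x ≤ l * x ^ 2 + 1 / (4 * l) := by
  have h : l * x ^ 2 + 1 / (4 * l) - x = (2 * l * x - 1) ^ 2 / (4 * l) := by
    field_simp; ring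
  have : 0 ≤ (2 * l * x - 1) ^ 2 / (4 * l) := by positivity
  linarith

/-- The weak solutions with bounded data are equicontinuous on compact subintervals. -/
theorem Splitting.exists_equicontinuous (hs : Splitting α A D K B) (e : D) {a b : ℝ}
    (ha : a ∈ Ioo (0 : ℝ) 1) (hb : b ∈ Ioo (0 : ℝ) 1) (R : ℝ) {η : ℝ} (hη : 0 < η) :
    ∃ ρ > 0, ∀ u h : WeightedL2 H α, ‖u‖ ≤ R → ‖h‖ ≤ R → ∀ G : ℝ → ℂ,
      IsPrimitive G (weakRHS α B u h e) → ∀ s ∈ Icc a b, ∀ t ∈ Icc a b, s ≤ t → t - s ≤ ρ →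
        ‖G t - G s‖ ≤ η := by
  have hα := hs.isWeight
  have hsub : Icc a b ⊆ Ioo 0 1 := fun t ht => ⟨ha.1.trans_le ht.1, ht.2.trans_lt hb.2⟩
  obtain ⟨Y₀, hY₀⟩ := isCompact_Icc.exists_bound_of_continuousOn
    ((hs.continuousOn_skewPart e).mono hsub)
  obtain ⟨M, hM⟩ := hα.bounded
  have hM0 : 0 < M := (hα.pos a ha).trans_le (hM a ha)
  set Y := max 1 (max Y₀ ‖(e : H)‖) with hYdef
  have hY1 : 0 < Y := zero_lt_one.trans_le (le_max_left _ _)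
  have hYe : ‖(e : H)‖ ≤ Y := (le_max_right _ _).trans (le_max_right _ _)
  have hYy : ∀ t ∈ Icc a b, ‖skewPart α B e t‖ ≤ Y := fun t ht =>
    (hY₀ t ht).trans ((le_max_left _ _).trans (le_max_right _ _))
  -- The bound `x ≤ l x² + 1/(4l)` splits the integral into an energy part, at most `2 Y l R² ≤
  -- η/2`, and a part proportional to the length, at most `η/2` for the chosen `ρ`.
  set l := η / (4 * Y * (R ^ 2 + 1)) with hl
  have hl0 : 0 < l := by positivity
  refine ⟨l * η / (Y * M), by positivity, fun u h hu hh G hG s hs' t ht hst hρ => ?_⟩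
  obtain ⟨hui, hun⟩ := hα.norm_sq_eq u
  obtain ⟨hhi, hhn⟩ := hα.norm_sq_eq h
  set Q : ℝ → ℝ := fun r => α r * ‖h r‖ ^ 2 + α r * ‖u r‖ ^ 2 with hQ
  have hQi : IntegrableOn Q (Ioo 0 1) := hhi.add hui
  have hQn : ∫ r in Ioo (0 : ℝ) 1, Q r = ‖h‖ ^ 2 + ‖u‖ ^ 2 := by
    rw [hhn, hun, ← integral_add hhi hui]
  have hsubI : Ioc s t ⊆ Icc a b := fun r hr => ⟨hs'.1.trans hr.1.le, hr.2.trans ht.2⟩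
  have hQI : IntervalIntegrable Q volume s t := by
    rw [intervalIntegrable_iff_integrableOn_Ioc_of_le hst]
    exact hQi.mono_set (hsubI.trans hsub)
  have hQle : ∫ r in s..t, Q r ≤ ‖h‖ ^ 2 + ‖u‖ ^ 2 := by
    rw [intervalIntegral.integral_of_le hst, ← hQn]
    refine setIntegral_mono_set hQi ?_ (hsubI.trans hsub).eventuallyLE
    filter_upwards [hα.ae_pos] with r hr
    simp only [hQ, Pi.zero_apply]
    positivity
  rw [hG.eq_add_integral (hsub hs') (hsub ht), add_sub_cancel_left]
  calc ‖∫ r in s..t, weakRHS α B u h e r‖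
      ≤ ∫ r in s..t, (Y * l * Q r + Y * M / (2 * l)) := by
        refine intervalIntegral.norm_integral_le_of_norm_le hst ?_
          ((hQI.const_mul _).add intervalIntegrable_const)
        refine Filter.Eventually.of_forall fun r hr => ?_
        have hrm := hsubI hr
        have hp := hα.pos r (hsub hrm)
        have hMr := hM r (hsub hrm)
        have e1 : ‖(inner ℂ (e : H) (h r) : ℂ)‖ ≤ Y * ‖h r‖ :=
          (norm_inner_le_norm _ _).trans (by gcongr)
        have e2 : ‖(inner ℂ (skewPart α B e r) (u r) : ℂ)‖ ≤ Y * ‖u r‖ :=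
          (norm_inner_le_norm _ _).trans (by gcongr; exact hYy r hrm)
        have e3 := le_mul_sq_add (x := ‖h r‖) hl0
        have e4 := le_mul_sq_add (x := ‖u r‖) hl0
        calc ‖weakRHS α B u h e r‖ ≤ α r * (Y * ‖h r‖) + α r * (Y * ‖u r‖) := by
              refine (norm_add_le _ _).trans ?_
              rw [norm_mul, norm_mul, Complex.norm_real, Real.norm_of_nonneg hp.le]
              gcongr
          _ ≤ α r * (Y * (l * ‖h r‖ ^ 2 + 1 / (4 * l))) +
              α r * (Y * (l * ‖u r‖ ^ 2 + 1 / (4 * l))) := by gcongr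
          _ = Y * l * Q r + Y * α r / (2 * l) := by
              simp only [hQ]; field_simp; ring
          _ ≤ Y * l * Q r + Y * M / (2 * l) := by gcongr
    _ = Y * l * (∫ r in s..t, Q r) + (t - s) * (Y * M / (2 * l)) := by
        rw [intervalIntegral.integral_add (hQI.const_mul _) intervalIntegrable_const,
          intervalIntegral.integral_const_mul, intervalIntegral.integral_const, smul_eq_mul]
    _ ≤ Y * l * (R ^ 2 + R ^ 2) + (l * η / (Y * M)) * (Y * M / (2 * l)) := by
        gcongr
        refine hQle.trans ?_
        gcongr
    _ ≤ η / 2 + η / 2 := by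
        have e1 : Y * l * (R ^ 2 + R ^ 2) = η / 2 * (R ^ 2 / (R ^ 2 + 1)) := by
          rw [hl]; field_simp; ring
        have e2 : R ^ 2 / (R ^ 2 + 1) ≤ 1 := by
          rw [div_le_one (by positivity)]; linarith
        have e3 : (l * η / (Y * M)) * (Y * M / (2 * l)) = η / 2 := by field_simp
        rw [e1, e3]
        gcongr
        nlinarith
    _ = η := by ring

theorem memLp_cell (hα : IsWeight α) {a b : ℝ} (hsub : Icc a b ⊆ Ioo 0 1) (m j : ℕ) (x : H) :
    MemLp (indicator {t | t ∈ Icc a b ∧ ⌊t * m⌋₊ = j} fun t => (α t)⁻¹ • x) 2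
      (weightMeasure α) := by
  have := hα.isFiniteMeasure
  have hmeas : MeasurableSet {t : ℝ | t ∈ Icc a b ∧ ⌊t * m⌋₊ = j} := by
    refine measurableSet_Icc.inter ?_
    exact (Nat.measurable_floor.comp (measurable_id.mul_const _)) (measurableSet_singleton j)
  have hcont : ContinuousOn (fun t => (α t)⁻¹ • x) (Icc a b) :=
    ((hα.contDiffOn.continuousOn.mono hsub).inv₀ fun t ht => (hα.pos t (hsub ht)).ne').smul
      continuousOn_const
  obtain ⟨c, hc⟩ := isCompact_Icc.exists_bound_of_continuousOn hcont
  refine MemLp.of_bound ?_ (max c 0) (Filter.Eventually.of_forall fun t => ?_)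
  · rw [aestronglyMeasurable_indicator_iff hmeas]
    exact (hcont.aestronglyMeasurable_of_isCompact isCompact_Icc measurableSet_Icc).mono_measure
      (Measure.restrict_mono (fun t ht => ht.1) le_rfl)
  · by_cases ht : t ∈ {t : ℝ | t ∈ Icc a b ∧ ⌊t * m⌋₊ = j}
    · rw [indicator_of_mem ht]
      exact (hc t ht.1).trans (le_max_left _ _)
    · rw [indicator_of_notMem ht, norm_zero]
      exact le_max_right _ _

theorem setIntegral_le_of_le_const_tails {f : ℝ → ℝ} {δ p q : ℝ} (hδ : 0 < δ) (hδ' : δ < 1 / 2)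
    (hp : 0 ≤ p) (hq : 0 ≤ q) (hf : IntegrableOn f (Ioo 0 1))
    (h : ∀ᵐ t ∂(volume.restrict (Ioo (0 : ℝ) 1)),
      (t ∈ Icc δ (1 - δ) → f t ≤ p) ∧ (t ∉ Icc δ (1 - δ) → f t ≤ q)) :
    ∫ t in Ioo (0 : ℝ) 1, f t ≤ p + 2 * δ * q := by
  have i1 : IntegrableOn (indicator (Ioo 0 δ) fun _ => q) (Ioo (0 : ℝ) 1) :=
    (integrableOn_const (by simp)).indicator measurableSet_Ioo
  have i2 : IntegrableOn (indicator (Ioo (1 - δ) 1) fun _ => q) (Ioo (0 : ℝ) 1) :=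
    (integrableOn_const (by simp)).indicator measurableSet_Ioo
  have i0 : IntegrableOn (fun _ : ℝ => p) (Ioo (0 : ℝ) 1) := integrableOn_const (by simp)
  have i12 : IntegrableOn (fun t => (indicator (Ioo 0 δ) fun _ => q) t +
      (indicator (Ioo (1 - δ) 1) fun _ => q) t) (Ioo (0 : ℝ) 1) := i1.add i2
  have hle : ∀ᵐ t ∂(volume.restrict (Ioo (0 : ℝ) 1)), f t ≤ p +
      ((indicator (Ioo 0 δ) fun _ => q) t + (indicator (Ioo (1 - δ) 1) fun _ => q) t) := by
    filter_upwards [h, ae_restrict_mem measurableSet_Ioo] with t ht hm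
    have n1 : 0 ≤ (indicator (Ioo 0 δ) fun _ => q) t := indicator_nonneg (fun _ _ => hq) t
    have n2 : 0 ≤ (indicator (Ioo (1 - δ) 1) fun _ => q) t := indicator_nonneg (fun _ _ => hq) t
    by_cases hI : t ∈ Icc δ (1 - δ)
    · linarith [ht.1 hI]
    · have hfq := ht.2 hI
      by_cases h1 : t < δ
      · rw [indicator_of_mem (s := Ioo 0 δ) ⟨hm.1, h1⟩]
        linarith
      · have h2 : 1 - δ < t := by
          by_contra hcon
          exact hI ⟨not_lt.1 h1, not_lt.1 hcon⟩
        have hm1 : t ∈ Ioo (1 - δ) 1 := ⟨h2, hm.2⟩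
        rw [indicator_of_mem (s := Ioo (1 - δ) 1) hm1]
        linarith
  refine (integral_mono_ae hf (i0.add i12) hle).trans ?_
  rw [integral_add' i0 i12, integral_add i1 i2, setIntegral_indicator measurableSet_Ioo,
    setIntegral_indicator measurableSet_Ioo, setIntegral_const, setIntegral_const,
    setIntegral_const]
  have s1 : Ioo (0 : ℝ) 1 ∩ Ioo 0 δ = Ioo 0 δ :=
    inter_eq_right.2 (Ioo_subset_Ioo le_rfl (by linarith))
  have s2 : Ioo (0 : ℝ) 1 ∩ Ioo (1 - δ) 1 = Ioo (1 - δ) 1 :=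
    inter_eq_right.2 (Ioo_subset_Ioo (by linarith) le_rfl)
  rw [s1, s2]
  simp only [Real.volume_real_Ioo, smul_eq_mul]
  rw [max_eq_left (by linarith), max_eq_left (by linarith), max_eq_left (by linarith)]
  linarith

/-- The components in a reducing subspace of the weak solutions with bounded data are uniformly
close to a finite dimensional space. -/
theorem Splitting.exists_finiteDimensional_approx [CompleteSpace H] (hs : Splitting α A D K B)
    {S : H →L[ℂ] H} {W : Submodule ℂ H} (hW : IsReducing S B W) [W.HasOrthogonalProjection]
    (R : ℝ) {ε : ℝ} (hε : 0 < ε) :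
    ∃ Z : Submodule ℂ (WeightedL2 H α), FiniteDimensional ℂ Z ∧
      ∀ u h : WeightedL2 H α, ‖u‖ ≤ R → ‖h‖ ≤ R →
        (∀ φ, IsRealTest φ → ∀ e : D, ∫ t, deriv φ t • ((α t : ℂ) * inner ℂ (e : H) (u t)) =
          -∫ t, φ t • weakRHS α B u h e t) →
        ∃ z ∈ Z, ‖W.starProjection.compLp u - z‖ ≤ ε := by
  have := hW.finiteDimensional
  have hα := hs.isWeight
  set n := Module.finrank ℂ W with hn
  let b : OrthonormalBasis (Fin n) ℂ W := stdOrthonormalBasis ℂ W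
  set q : ℝ := 3 * R ^ 2 with hq
  -- The end intervals have total length `2δ` and the energy there is at most `q`, so they
  -- contribute at most `ε²/2`.
  set δ : ℝ := min (1 / 4) (ε ^ 2 / (4 * (q + 1))) with hδ
  have hδ0 : 0 < δ := by
    rw [hδ]; positivity
  have hδ4 : δ ≤ 1 / 4 := min_le_left _ _
  have hδa : δ ∈ Ioo (0 : ℝ) 1 := ⟨hδ0, by linarith⟩
  have hδb : 1 - δ ∈ Ioo (0 : ℝ) 1 := ⟨by linarith, by linarith⟩
  have hsub : Icc δ (1 - δ) ⊆ Ioo 0 1 := fun t ht => ⟨hδ0.trans_le ht.1, ht.2.trans_lt hδb.2⟩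
  obtain ⟨t₀, ht₀, hmin⟩ := isCompact_Icc.exists_isMinOn (nonempty_Icc.2 (by linarith))
    (hα.contDiffOn.continuousOn.mono hsub)
  have hα₀ : 0 < α t₀ := hα.pos t₀ (hsub ht₀)
  -- Makes `n η² / α ≤ ε²/2` on the middle interval, where `α t₀` is the minimum of the weight; the
  -- cap `1` serves `η² ≤ η`.
  set η : ℝ := min 1 (α t₀ * ε ^ 2 / (2 * (n + 1))) with hη
  have hη0 : 0 < η := by rw [hη]; positivity
  have hηsq : n * η ^ 2 ≤ α t₀ * ε ^ 2 / 2 := by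
    have h1 : η ^ 2 ≤ η := by nlinarith [min_le_left 1 (α t₀ * ε ^ 2 / (2 * ((n : ℝ) + 1)))]
    have h2 : η ≤ α t₀ * ε ^ 2 / (2 * (n + 1)) := min_le_right _ _
    calc n * η ^ 2 ≤ (n + 1) * (α t₀ * ε ^ 2 / (2 * (n + 1))) := by
          have : (n : ℝ) ≤ n + 1 := by linarith
          gcongr
          exact h1.trans h2
      _ = α t₀ * ε ^ 2 / 2 := by field_simp
  choose ρ hρ0 hρ using fun k => hs.exists_equicontinuous ⟨b k, hW.le (b k).2⟩ hδa hδb R hη0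
  choose N hN using fun k => exists_nat_one_div_lt (hρ0 k)
  set m : ℕ := Finset.univ.sup N + 1 with hm
  have hm0 : (0 : ℝ) < m := by rw [hm]; positivity
  have hmρ : ∀ k, 1 / (m : ℝ) ≤ ρ k := fun k => by
    refine le_trans ?_ (hN k).le
    have : N k ≤ Finset.univ.sup N := Finset.le_sup (Finset.mem_univ k)
    rw [hm]; push_cast
    gcongr
  -- Left endpoints of the mesh cells, cut off at `δ` so that the node of every occupied cell stays
  -- in the compact interval.
  set τ : ℕ → ℝ := fun j => max δ (j / m) with hτ
  have hτmem : ∀ t ∈ Icc δ (1 - δ), τ ⌊t * m⌋₊ ∈ Icc δ (1 - δ) ∧ τ ⌊t * m⌋₊ ≤ t ∧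
      t - τ ⌊t * m⌋₊ ≤ 1 / m := by
    intro t ht
    have ht0 : 0 ≤ t := hδ0.le.trans ht.1
    have h1 : ((⌊t * m⌋₊ : ℝ)) / m ≤ t := by
      rw [div_le_iff₀ hm0]; exact Nat.floor_le (by positivity)
    have h2 : t ≤ ((⌊t * m⌋₊ : ℝ)) / m + 1 / m := by
      rw [← add_div, le_div_iff₀ hm0]; exact (Nat.lt_floor_add_one _).le
    have h3 : τ ⌊t * m⌋₊ ≤ t := max_le ht.1 h1
    refine ⟨⟨le_max_left _ _, h3.trans ht.2⟩, h3, ?_⟩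
    have : ((⌊t * m⌋₊ : ℝ)) / m ≤ τ ⌊t * m⌋₊ := le_max_right _ _
    linarith
  -- The step functions approximate `α ⟪b k, u⟫`, so the basis carries the factor `α⁻¹`; it does not
  -- depend on `u`. Cell numbers run up to `m`.
  let c : Fin n → Fin (m + 1) → WeightedL2 H α := fun k j =>
    (memLp_cell hα hsub m j (b k : H)).toLp
  refine ⟨Submodule.span ℂ (range fun p : Fin n × Fin (m + 1) => c p.1 p.2),
    FiniteDimensional.span_of_finite ℂ (finite_range _), fun u h hu hh hw => ?_⟩
  choose G hG hGu using fun k : Fin n => hs.exists_isPrimitive (u := u) (h := h)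
    ⟨b k, hW.le (b k).2⟩ fun φ hφ => hw φ hφ _
  refine ⟨∑ k, ∑ j : Fin (m + 1), G k (τ j) • c k j,
    Submodule.sum_mem _ fun k _ => Submodule.sum_mem _ fun j _ =>
      Submodule.smul_mem _ _ (Submodule.subset_span ⟨(k, j), rfl⟩), ?_⟩
  set z : WeightedL2 H α := ∑ k, ∑ j : Fin (m + 1), G k (τ j) • c k j with hz
  have hzt : ∀ᵐ t ∂(volume.restrict (Ioo (0 : ℝ) 1)), z t = ∑ k, ∑ j : Fin (m + 1),
      G k (τ j) • (indicator {t | t ∈ Icc δ (1 - δ) ∧ ⌊t * m⌋₊ = j}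
        fun t => (α t)⁻¹ • (b k : H)) t := by
    rw [← hα.ae_eq]
    have h1 : ∀ᵐ t ∂(weightMeasure α), ∀ k (j : Fin (m + 1)), (G k (τ j) • c k j : WeightedL2 H α) t =
        G k (τ j) • (indicator {t | t ∈ Icc δ (1 - δ) ∧ ⌊t * m⌋₊ = j}
          fun t => (α t)⁻¹ • (b k : H)) t := by
      refine ae_all_iff.2 fun k => ae_all_iff.2 fun j => ?_
      filter_upwards [Lp.coeFn_smul (G k (τ j)) (c k j),
        (memLp_cell hα hsub m j (b k : H)).coeFn_toLp] with t h1 h2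
      rw [h1, Pi.smul_apply, h2]
    have h2 : ∀ᵐ t ∂(weightMeasure α), ∀ k, (∑ j : Fin (m + 1), G k (τ j) • c k j :
        WeightedL2 H α) t = ∑ j : Fin (m + 1), (G k (τ j) • c k j : WeightedL2 H α) t :=
      ae_all_iff.2 fun k => by
        filter_upwards [Lp.coeFn_fun_finsetSum Finset.univ fun j : Fin (m + 1) => G k (τ j) • c k j]
          with t ht
        rw [ht]
    filter_upwards [h1, h2, Lp.coeFn_fun_finsetSum Finset.univ
      fun k => ∑ j : Fin (m + 1), G k (τ j) • c k j] with t h1 h2 h3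
    rw [hz, h3]
    refine Finset.sum_congr rfl fun k _ => ?_
    rw [h2]
    exact Finset.sum_congr rfl fun j _ => h1 k j
  set x := W.starProjection.compLp u - z with hx
  obtain ⟨hxi, hxn⟩ := hα.norm_sq_eq x
  have hR : 2 * ‖u‖ ^ 2 + ‖h‖ ^ 2 ≤ q := by
    have h1 : ‖u‖ ^ 2 ≤ R ^ 2 := by gcongr
    have h2 : ‖h‖ ^ 2 ≤ R ^ 2 := by gcongr
    rw [hq]; linarith
  have hxt : ∀ᵐ t ∂(volume.restrict (Ioo (0 : ℝ) 1)),
      x t = W.starProjection (u t) - z t := by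
    rw [← hα.ae_eq]
    filter_upwards [Lp.coeFn_sub (W.starProjection.compLp u) z,
      W.starProjection.coeFn_compLp u] with t h1 h2
    rw [h1, Pi.sub_apply, h2]
  have hbound := setIntegral_le_of_le_const_tails (p := ε ^ 2 / 2) (q := q) hδ0 (by linarith)
    (by positivity) (by positivity) hxi (by
      filter_upwards [hxt, hzt, ae_all_iff.2 hGu, ae_restrict_mem measurableSet_Ioo]
        with t h1 h2 h3 htI
      have hpos := hα.pos t htI
      have hproj : W.starProjection (u t) = ∑ k, (((α t)⁻¹ : ℝ) * G k t : ℂ) • (b k : H) := by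
        rw [starProjection_eq_sum b]
        refine Finset.sum_congr rfl fun k _ => ?_
        rw [← h3 k, ← mul_assoc, ← Complex.ofReal_mul, inv_mul_cancel₀ hpos.ne',
          Complex.ofReal_one, one_mul]
      constructor
      · intro ht
        obtain ⟨hτ1, hτ2, hτ3⟩ := hτmem t ht
        have hj : ⌊t * m⌋₊ < m + 1 := by
          rw [Nat.lt_succ_iff]
          refine Nat.floor_le_of_le ?_
          have : t ≤ 1 := htI.2.le
          nlinarith
        have hzval : z t = ∑ k, (((α t)⁻¹ : ℝ) * G k (τ ⌊t * m⌋₊) : ℂ) • (b k : H) := by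
          rw [h2]
          refine Finset.sum_congr rfl fun k _ => ?_
          rw [Finset.sum_eq_single (⟨⌊t * m⌋₊, hj⟩ : Fin (m + 1))]
          · rw [indicator_of_mem (s := {r | r ∈ Icc δ (1 - δ) ∧ ⌊r * m⌋₊ =
              ((⟨⌊t * m⌋₊, hj⟩ : Fin (m + 1)) : ℕ)}) ⟨ht, rfl⟩, ← Complex.coe_smul, smul_smul, mul_comm]
          · intro j _ hne
            rw [indicator_of_notMem, smul_zero]
            rintro ⟨-, h⟩
            exact hne (Fin.ext h.symm)
          · intro h; exact absurd (Finset.mem_univ _) h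
        have hdiff : x t = ∑ k, (((α t)⁻¹ : ℝ) * (G k t - G k (τ ⌊t * m⌋₊)) : ℂ) • (b k : H) := by
          rw [h1, hproj, hzval, ← Finset.sum_sub_distrib]
          refine Finset.sum_congr rfl fun k _ => ?_
          rw [← sub_smul, mul_sub]
        rw [hdiff, norm_sq_sum_smul]
        have hαt : α t₀ ≤ α t := hmin ht
        calc α t * ∑ k, ‖(((α t)⁻¹ : ℝ) * (G k t - G k (τ ⌊t * m⌋₊)) : ℂ)‖ ^ 2
            ≤ α t * ∑ _k : Fin n, ((α t)⁻¹ * η) ^ 2 := by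
              gcongr with k
              rw [norm_mul, Complex.norm_real, Real.norm_of_nonneg (inv_pos.2 hpos).le]
              gcongr
              exact hρ k u h hu hh (G k) (hG k) _ hτ1 t ht hτ2 (hτ3.trans (hmρ k))
          _ = (n * η ^ 2) / α t := by
              rw [Finset.sum_const, Finset.card_univ, Fintype.card_fin, nsmul_eq_mul]
              field_simp
          _ ≤ (α t₀ * ε ^ 2 / 2) / α t₀ := by gcongr
          _ = ε ^ 2 / 2 := by field_simp
      · intro ht
        have hz0 : z t = 0 := by
          rw [h2]
          refine Finset.sum_eq_zero fun k _ => Finset.sum_eq_zero fun j _ => ?_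
          rw [indicator_of_notMem fun h => ht h.1, smul_zero]
        rw [h1, hz0, sub_zero, hproj, norm_sq_sum_smul]
        refine le_trans (le_of_eq ?_) ((hs.sum_sq_norm_div_le hW b hG hGu htI).trans hR)
        simp_rw [norm_mul, mul_pow, Complex.norm_real,
          Real.norm_of_nonneg (inv_pos.2 hpos).le, ← Finset.mul_sum]
        field_simp)
  rw [← hxn] at hbound
  refine le_of_sq_le_sq (hbound.trans ?_) hε.le
  have h1 : δ * (4 * (q + 1)) ≤ ε ^ 2 := by
    rw [← le_div_iff₀ (by positivity)]; exact min_le_right _ _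
  nlinarith

end Approximation

/-! ### Conclusion. -/

section Compactness

variable {H : Type*} [NormedAddCommGroup H] [InnerProductSpace ℂ H]
  {α : ℝ → ℝ} {A : ℝ → H →ₗ.[ℂ] H} {D : Submodule ℂ H} {K : D →ₗ[ℂ] H} {B : ℝ → D →ₗ[ℂ] H}

theorem dense_comap_of_isReducing [CompleteSpace H] {S : H →L[ℂ] H} (hcomp : IsCompactOperator S)
    (hsym : (S : H →ₗ[ℂ] H).IsSymmetric)
    (hred : ∀ z : ℂ, IsReducing S B (Module.End.eigenspace (S : Module.End ℂ H) z)) :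
    Dense ((D.comap (S : H →ₗ[ℂ] H) : Submodule ℂ H) : Set H) := by
  have h1 : Dense ((⨆ z, Module.End.eigenspace (S : Module.End ℂ H) z : Submodule ℂ H) : Set H) := by
    rw [Submodule.dense_iff_topologicalClosure_eq_top, Submodule.topologicalClosure_eq_top_iff]
    exact ContinuousLinearMap.orthogonalComplement_iSup_eigenspaces_eq_bot hcomp hsym
  have hle : (⨆ z, Module.End.eigenspace (S : Module.End ℂ H) z : Submodule ℂ H) ≤
      D.comap (S : H →ₗ[ℂ] H) :=
    iSup_le fun z x hx => (hred z).le ((hred z).apply_mem x hx)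
  exact h1.mono hle

/-- The error splits in two: `u - P_W u = S w - P_W S w` is small by compactness of `S`, and `P_W u`
is close to a fixed finite dimensional space by the estimates in `t`. -/
theorem Splitting.hasCompactInverse [CompleteSpace H] [TopologicalSpace.SeparableSpace H]
    (hs : Splitting α A D K B) {S : H →L[ℂ] H} (hcomp : IsCompactOperator S)
    (hsym : (S : H →ₗ[ℂ] H).IsSymmetric) (hinj : Function.Injective S)
    (hSK : ∀ e : D, S (K e) = e)
    (hred : ∀ z : ℂ, IsReducing S B (Module.End.eigenspace (S : Module.End ℂ H) z))
    {L : WeightedL2 H α →ₗ.[ℂ] WeightedL2 H α} (hL : IsNormalExtension α A D L) :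
    HasCompactInverse L := by
  have hα := hs.isWeight
  have hK : ∀ e f : D, inner ℂ (K e) (f : H) = inner ℂ (e : H) (K f) := by
    intro e f
    have h := hsym (K e) (K f)
    simp only [ContinuousLinearMap.coe_coe] at h
    rw [hSK, hSK] at h
    exact h.symm
  have hdense := dense_comap_of_isReducing hcomp hsym hred
  have hparts : ∀ u v, (u, v) ∈ L.graph → ∃ w h : WeightedL2 H α, ‖w‖ ≤ ‖v‖ ∧ ‖h‖ ≤ ‖v‖ ∧
      u = S.compLp w ∧
      ∀ φ, IsRealTest φ → ∀ e : D, ∫ t, deriv φ t • ((α t : ℂ) * inner ℂ (e : H) (u t)) =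
        -∫ t, φ t • weakRHS α B u h e t := by
    intro u v huv
    obtain ⟨w, h, hw, hh, h1, h2⟩ := hs.exists_weak_parts hK hL huv
    exact ⟨w, h, hw, hh, hs.eq_compLp hsym hinj hSK hdense h1, h2⟩
  have hbound : ∀ u v, (u, v) ∈ L.graph → ‖u‖ ≤ ‖S‖ * ‖v‖ := by
    intro u v huv
    obtain ⟨w, h, hw, -, rfl, -⟩ := hparts u v huv
    exact (S.norm_compLp_le w).trans (by gcongr)
  refine hL.1.hasCompactInverse hbound fun ε hε => ?_
  obtain ⟨W, hW, hWS⟩ := exists_isReducing_norm_sub_le hcomp hsym hred (half_pos hε)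
  have := hW.finiteDimensional
  obtain ⟨Z, hZ, happ⟩ := hs.exists_finiteDimensional_approx hW (max ‖S‖ 1) (half_pos hε)
  refine ⟨Z, hZ, fun u v huv hv => ?_⟩
  obtain ⟨w, h, hw, hh, huw, hweak⟩ := hparts u v huv
  have hu : ‖u‖ ≤ max ‖S‖ 1 := by
    refine ((hbound u v huv).trans ?_).trans (le_max_left _ _)
    exact mul_le_of_le_one_right (norm_nonneg _) hv
  obtain ⟨z, hz, hzle⟩ := happ u h hu ((hh.trans hv).trans (le_max_right _ _)) hweak
  refine ⟨z, hz, ?_⟩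
  have hP : ‖u - W.starProjection.compLp u‖ ≤ ε / 2 * ‖w‖ := by
    refine Lp.norm_le_mul_norm_of_ae_le_mul ?_
    have hSw := S.coeFn_compLp w
    rw [← huw] at hSw
    filter_upwards [Lp.coeFn_sub u (W.starProjection.compLp u),
      W.starProjection.coeFn_compLp u, hSw] with t h1 h2 h3
    rw [h1, Pi.sub_apply, h2, h3]
    exact hWS inferInstance (w t)
  calc ‖u - z‖ ≤ ‖u - W.starProjection.compLp u‖ + ‖W.starProjection.compLp u - z‖ :=
        norm_sub_le_norm_sub_add_norm_sub _ _ _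
    _ ≤ ε / 2 * ‖w‖ + ε / 2 := add_le_add hP hzle
    _ ≤ ε / 2 * 1 + ε / 2 := by gcongr; exact hw.trans hv
    _ = ε := by ring

end Compactness

end NormalDiffOp

theorem theorem8 {H : Type*} [NormedAddCommGroup H] [InnerProductSpace ℂ H] [CompleteSpace H]
    [TopologicalSpace.SeparableSpace H]
    -- the weight
    (α : ℝ → ℝ) (hα : ContDiffOn ℝ 2 α (Icc 0 1)) (hα_nonneg : ∀ t ∈ Icc (0 : ℝ) 1, 0 ≤ α t)
    (hα_zero : volume {t ∈ Icc (0 : ℝ) 1 | α t = 0} = 0)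
    -- the operator coefficient `A(t) = A_r(t) + i A_i(t)`, with constant dense domain `D`
    (Ar Ai A : ℝ → H →ₗ.[ℂ] H) (D : Submodule ℂ H)
    (hA : ∀ t ∈ Ioo (0 : ℝ) 1, A t = Ar t + Complex.I • Ai t)
    (hD : ∀ t ∈ Ioo (0 : ℝ) 1, (A t).domain = D) (hD_dense : Dense (D : Set H))
    (hAr : ∀ t ∈ Ioo (0 : ℝ) 1, IsSelfAdjoint (Ar t))
    (hAi : ∀ t ∈ Ioo (0 : ℝ) 1, IsSelfAdjoint (Ai t))
    (hcomm : ∀ t ∈ Ioo (0 : ℝ) 1, NormalDiffOp.StronglyCommute (Ar t) (Ai t))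
    (hAr_C1 : NormalDiffOp.StronglyC1 Ar D) (hAi_C1 : NormalDiffOp.StronglyC1 Ai D)
    -- `A_r(t) = (α'(t) / (2 α(t))) I + C` for a.e. `t`, with `C` positive
    (C : H →ₗ.[ℂ] H) (hC : IsSelfAdjoint C)
    (hC_pos : ∀ x : C.domain, 0 ≤ (inner ℂ (C x) (x : H)).re)
    (hArC : ∀ᵐ t ∂(volume.restrict (Ioo (0 : ℝ) 1)),
      Ar t = (((deriv α t / (2 * α t) : ℝ) : ℂ) • (LinearMap.id : H →ₗ[ℂ] H)) +ᵥ C)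
    -- `C⁻¹ ∈ 𝔖_∞(H)`
    (hC_inv : NormalDiffOp.HasCompactInverse C)
    -- an arbitrary normal extension `L_W` of the minimal operator
    (L : NormalDiffOp.WeightedL2 H α →ₗ.[ℂ] NormalDiffOp.WeightedL2 H α)
    (hL : NormalDiffOp.IsNormalExtension α A D L) :
    NormalDiffOp.HasCompactInverse L := by
  -- Positivity of `α` is read off from a nonzero vector of `D`, so the zero space is treated apart.
  rcases subsingleton_or_nontrivial H with hH | hH
  · have hsub : Subsingleton (NormalDiffOp.WeightedL2 H α) :=
      ⟨fun x y => Lp.ext (Filter.Eventually.of_forall fun t => Subsingleton.elim _ _)⟩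
    refine ⟨0, isCompactOperator_zero, fun x y => ⟨fun _ => Subsingleton.elim _ _, fun _ => ?_⟩⟩
    rw [Subsingleton.elim (x, y) 0]
    exact L.graph.zero_mem
  obtain ⟨S, hcomp, hS⟩ := hC_inv
  have hsym := NormalDiffOp.isSymmetric_of_graph_eq hC hS
  obtain ⟨K, B, hs, hSK, hred⟩ := NormalDiffOp.exists_splitting α hα hα_nonneg hα_zero Ar Ai A D hA
    hD hD_dense hAi hcomm hAr_C1 hAi_C1 C hArC hS hsym hcomp
  exact hs.hasCompactInverse hcomp hsym (NormalDiffOp.injective_of_graph_eq hS) hSK hred hL
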